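/- All graphs are finite and simple. A graph is \emph{subcubic} if its maximum degree is at most $3$, and \emph{outerplanar} if it has a planar embedding in which every vertex lies on the boundary of the outer (unbounded) face. Write $d_G(u,v)$ for the distance of $u$ and $v$ in $G$ (with $d_G(u,v)=\infty$ if $u,v$ lie in different components). For positive integers $t\le k$, a \emph{$t$-tone $k$-coloring} of $G$ assigns to each vertex $v$ a $t$-element set $f(v)\subseteq\{1,\dots,k\}$ such that $|f(u)\cap f(v)|<d_G(u,v)$ for all distinct vertices $u,v$; $G$ is \emph{$t$-tone $k$-colorable} if it has such a coloring, and $\tau_t(G)$ is the least such $k$. A \emph{$3$-good $k$-coloring} of $G$ assigns to each vertex a $3$-element subset of $\{1,\dots,k\}$ such that adjacent vertices receive disjoint sets and any two vertices at distance two share exactly one color. \textbf{Theorem.} Every subcubic outerplanar graph $G$ has a $3$-good $11$-coloring. Hence $G$ is $3$-tone $11$-colorable, that is, $\tau_3(G)\le 11$. The bound is sharp, even for graphs that do not contain $K_4-e$ (the complete graph $K_4$ minus an edge) as a subgraph: the graph with vertices $v_1,\dots,v_5$ and edges $v_1v_2, v_2v_5, v_5v_4, v_4v_3, v_3v_1,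 v_2v_3$ (a $5$-cycle with one chord) is subcubic and outerplanar, does not contain $K_4-e$, is not $3$-tone $10$-colorable, and satisfies $\tau_3=11$. -/

import Mathlib

namespace ToneColoring

/-- The Euclidean plane. -/
abbrev Plane : Type := EuclideanSpace ℝ (Fin 2)

/-- A planar embedding (a drawing without crossings) of a graph `G`: vertices are distinct points,
each edge is a simple arc joining the points of its two ends, an arc meets no vertices other than
its ends, and two distinct arcs meet in vertices only. The value of `arc` off the edge set
of `G` is irrelevant. -/
structure PlanarEmbedding {V : Type*} (G : SimpleGraph V) where
  point : V → Plane
  arc : Sym2 V → Set Plane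
  point_injective : Function.Injective point
  isArc : ∀ u v : V, G.Adj u v →
    ∃ γ : Path (point u) (point v), Function.Injective γ ∧ Set.range γ = arc s(u, v)
  mem_of_point_mem_arc : ∀ e ∈ G.edgeSet, ∀ w : V, point w ∈ arc e → w ∈ e
  arc_inter_arc : ∀ e ∈ G.edgeSet, ∀ e' ∈ G.edgeSet, e ≠ e' → arc e ∩ arc e' ⊆ Set.range point

namespace PlanarEmbedding

variable {V : Type*} {G : SimpleGraph V}

/-- The point set of the drawing: the union of all vertices and all edges. -/
def support (E : PlanarEmbedding G) : Set Plane :=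
  Set.range E.point ∪ ⋃ e ∈ G.edgeSet, E.arc e

/-- The faces are the connected components of the complement of the drawing. -/
def IsFace (E : PlanarEmbedding G) (F : Set Plane) : Prop :=
  ∃ x ∈ E.supportᶜ, F = connectedComponentIn E.supportᶜ x

/-- The outer face is the unbounded face. -/
def IsOuterFace (E : PlanarEmbedding G) (F : Set Plane) : Prop :=
  E.IsFace F ∧ ¬ Bornology.IsBounded F

end PlanarEmbedding

/-- A graph is outerplanar if it has a planar embedding in which every vertex lies on the
boundary of the outer face. -/
def IsOuterplanar {V : Type*} (G : SimpleGraph V) : Prop :=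
  ∃ E : PlanarEmbedding G, ∃ F : Set Plane, E.IsOuterFace F ∧ ∀ v : V, E.point v ∈ frontier F

open Classical in
/-- A finite graph is subcubic if its maximum degree is at most three. -/
def IsSubcubic {V : Type*} [Fintype V] (G : SimpleGraph V) : Prop :=
  G.maxDegree ≤ 3

/-- `f` is a `t`-tone `k`-coloring of `G`, with the `k` colors being the elements of `Fin k`.
Distances are extended distances: vertices in different components are at distance `⊤`. -/
def IsToneColoring {V : Type*} (G : SimpleGraph V) (t k : ℕ) (f : V → Finset (Fin k)) : Prop :=
  (∀ v, (f v).card = t) ∧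
    ∀ u v, u ≠ v → ((f u ∩ f v).card : ℕ∞) < G.edist u v

/-- `G` is `t`-tone `k`-colorable. -/
def ToneColorable {V : Type*} (G : SimpleGraph V) (t k : ℕ) : Prop :=
  0 < t ∧ t ≤ k ∧ ∃ f : V → Finset (Fin k), IsToneColoring G t k f

/-- The `t`-tone chromatic number: the least `k` such that `G` is `t`-tone `k`-colorable. -/
noncomputable def toneChromaticNumber {V : Type*} (G : SimpleGraph V) (t : ℕ) : ℕ :=
  sInf {k : ℕ | ToneColorable G t k}

/-- `f` is a 3-good `k`-coloring of `G`: labels are 3-sets of colors, adjacent vertices have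
disjoint labels, and vertices at distance two share exactly one color. -/
def IsThreeGoodColoring {V : Type*} (G : SimpleGraph V) (k : ℕ) (f : V → Finset (Fin k)) : Prop :=
  (∀ v, (f v).card = 3) ∧
    (∀ u v, G.Adj u v → Disjoint (f u) (f v)) ∧
    ∀ u v, G.edist u v = 2 → (f u ∩ f v).card = 1

/-- The 5-cycle `0 1 4 3 2` with the chord `{1, 2}`. -/
def houseGraph : SimpleGraph (Fin 5) :=
  SimpleGraph.fromEdgeSet {s(0, 1), s(1, 4), s(4, 3), s(3, 2), s(2, 0), s(1, 2)}

/-- The complete graph on four vertices with one edge removed. -/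
def completeFourMinusEdge : SimpleGraph (Fin 4) :=
  (⊤ : SimpleGraph (Fin 4)).deleteEdges {s(0, 1)}

end ToneColoring

/-! A good coloring is grown on a vertex set `S`, starting from the empty set, so that edges from
`S` into one component of its complement coincide or have adjacent ends in `S` (`IsClosedUnder`). If
two edges, at adjacent `x` and `y`, enter a component, a shortest path through that component closes
an induced cycle with the edge `x y`, and this cycle is added (`exists_extension_of_edge`). A third
such edge would give a `K₄` minor. If at most one edge enters, at `r`, an induced cycle through `r`
outside `S` is added, or `r` alone when there is none (`exists_extension_of_vertex`). The invariant
survives because nonadjacent vertices of an induced cycle that are joined outside it would span a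
`K₂,₃` subdivision, and because in a subcubic graph a cycle vertex has at most one neighbor off the
cycle.

Each step is a finite problem on labels. The new cycle carries one or two prescribed labels, and the
vertices near it in `S` impose only a few intersection conditions. Up to permutations of the eleven
colors few configurations remain, and arbitrarily long cycles are filled by a valid pattern of
labels of period four with one of four endings (`exists_isLadder_of_four_cycle`).

The excluded configurations come from topology. A point of the outer face, joined to all vertices,
turns `K₂,₃` into `K₃,₃` and `K₄` into `K₅`. Neither has a drawing in which disjoint edges stay
apart: following the logarithm of `α s - β t` around the unit square gives one integer relation per
pair of disjoint edges (`exists_vanKampen_relation`), and these relations contradict each other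
modulo 2.

Sharpness is a count of the colors needed by the triangle and the remaining edge of the house graph;
its outerplanarity is shown by placing the vertices on a parabola. -/

/-! ### Continuous logarithms and the van Kampen obstruction in the plane -/

open unitInterval in
/-- A nowhere vanishing continuous function on the unit square has a continuous logarithm. -/
theorem exists_continuous_log_square (g : C(I × I, ℂ)) (hg : ∀ z, g z ≠ 0) :
    ∃ L : C(I × I, ℂ), ∀ z, Complex.exp (L z) = g z := by
  have : LocallyPathConnectedSpace I :=
    (convex_Icc (0 : ℝ) 1).locallyPathConnectedSpace
  have : ContractibleSpace I := (convex_Icc (0 : ℝ) 1).contractibleSpace ⟨0, by simp⟩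
  obtain ⟨f, ⟨-, hf⟩, -⟩ := Complex.isCoveringMapOn_exp.existsUnique_continuousMap_lifts
    g (Complex.exp_log (hg (0, 0))) (fun z ↦ hg z)
  exact ⟨f, fun z ↦ congrFun hf z⟩

open unitInterval in
theorem exists_continuous_log_interval (g : C(I, ℂ)) (hg : ∀ z, g z ≠ 0) :
    ∃ L : C(I, ℂ), ∀ z, Complex.exp (L z) = g z := by
  obtain ⟨L, hL⟩ := exists_continuous_log_square (g.comp ⟨Prod.fst, continuous_fst⟩)
    (fun z ↦ hg z.1)
  exact ⟨L.comp ⟨fun t ↦ (t, 0), by fun_prop⟩, fun z ↦ hL (z, 0)⟩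

open unitInterval in
/-- Two continuous logarithms of the same function have the same increment. -/
theorem log_increment_unique (L M : C(I, ℂ))
    (h : ∀ t, Complex.exp (L t) = Complex.exp (M t)) : L 1 - L 0 = M 1 - M 0 := by
  have hd : ∀ t, ∃ n : ℤ, L t - M t = n * (2 * Real.pi * Complex.I) := by
    intro t
    obtain ⟨n, hn⟩ := Complex.exp_eq_exp_iff_exists_int.1 (h t)
    exact ⟨n, by rw [hn]; ring⟩
  choose n hn using hd
  have hc : Continuous fun t ↦ ((n t : ℤ) : ℝ) := by
    have : (fun t ↦ ((n t : ℤ) : ℝ)) =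
        fun t ↦ ((L t - M t) / (2 * Real.pi * Complex.I)).re := by
      funext t
      rw [hn t, mul_div_cancel_right₀ _ Complex.two_pi_I_ne_zero]
      simp
    rw [this]
    fun_prop
  have hn' : Continuous n := Int.isClosedEmbedding_coe_real.isInducing.continuous_iff.2 hc
  have := PreconnectedSpace.constant (inferInstance : PreconnectedSpace I) hn' (x := 1) (y := 0)
  have h1 := hn 1
  have h0 := hn 0
  rw [this] at h1
  linear_combination h1 - h0

open unitInterval in
/-- The increment of a continuous logarithm of `γ - z` along the path `γ`. -/
noncomputable def logIncrement {u v : ℂ} (γ : Path u v) (z : ℂ) : ℂ :=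
  open Classical in
  if h : ∃ L : C(I, ℂ), ∀ t, Complex.exp (L t) = γ t - z then h.choose 1 - h.choose 0 else 0

open unitInterval in
theorem logIncrement_eq {u v : ℂ} (γ : Path u v) (z : ℂ) (L : C(I, ℂ))
    (hL : ∀ t, Complex.exp (L t) = γ t - z) : logIncrement γ z = L 1 - L 0 := by
  have h : ∃ L : C(I, ℂ), ∀ t, Complex.exp (L t) = γ t - z := ⟨L, hL⟩
  rw [logIncrement, dif_pos h]
  exact log_increment_unique _ _ fun t ↦ (h.choose_spec t).trans (hL t).symm

-- This determines the increment modulo `2πi` from the ends of the path alone; the remaining integer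
-- is the datum `N` of the van Kampen relations.
open unitInterval in
theorem exp_logIncrement {u v : ℂ} (γ : Path u v) (z : ℂ) (hz : ∀ t, γ t ≠ z) :
    Complex.exp (logIncrement γ z) * (u - z) = v - z := by
  obtain ⟨L, hL⟩ := exists_continuous_log_interval
    ⟨fun t ↦ γ t - z, by fun_prop⟩ (fun t ↦ sub_ne_zero.2 (hz t))
  have hL' : ∀ t, Complex.exp (L t) = γ t - z := hL
  have h0 := hL' 0
  have h1 := hL' 1
  rw [Path.source] at h0
  rw [Path.target] at h1
  rw [logIncrement_eq γ z L hL', Complex.exp_sub, ← h0, ← h1,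
    div_mul_cancel₀ _ (Complex.exp_ne_zero _)]

open unitInterval in
/-- The cocycle relation for a pair of disjoint paths. -/
theorem logIncrement_add_eq {u v x y : ℂ} (α : Path u v) (β : Path x y)
    (h : ∀ s t, α s ≠ β t) :
    logIncrement α x + logIncrement β v = logIncrement α y + logIncrement β u := by
  obtain ⟨L, hL⟩ := exists_continuous_log_square
    ⟨fun z ↦ α z.1 - β z.2, by fun_prop⟩ (fun z ↦ sub_ne_zero.2 (h z.1 z.2))
  have hL' : ∀ s t, Complex.exp (L (s, t)) = α s - β t := fun s t ↦ hL (s, t)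
  have hneg : ∀ s t, Complex.exp (L (s, t) + Real.pi * Complex.I) = β t - α s := by
    intro s t
    rw [Complex.exp_add, Complex.exp_pi_mul_I, hL']
    ring
  rw [logIncrement_eq α x (L.comp ⟨fun s ↦ (s, 0), by fun_prop⟩)
      (fun s ↦ by simpa using hL' s 0),
    logIncrement_eq α y (L.comp ⟨fun s ↦ (s, 1), by fun_prop⟩)
      (fun s ↦ by simpa using hL' s 1),
    logIncrement_eq β v (L.comp ⟨fun s ↦ (1, s), by fun_prop⟩ + .const I (Real.pi * Complex.I))
      (fun s ↦ by simpa using hneg 1 s),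
    logIncrement_eq β u (L.comp ⟨fun s ↦ (0, s), by fun_prop⟩ + .const I (Real.pi * Complex.I))
      (fun s ↦ by simpa using hneg 0 s)]
  simp

/-- The van Kampen relations of a drawing in the plane: `N i j k` counts the turns of the edge
`i j` around the vertex `k`, relative to a drawing with vertices in convex position. -/
theorem exists_vanKampen_relation {ι : Type*} [LinearOrder ι] (P : ι → ℂ)
    (hP : Function.Injective P) (E : ι → ι → Prop) (A : ι → ι → Set ℂ)
    (hA : ∀ i j, i < j → E i j → JoinedIn (A i j) (P i) (P j)) :
    ∃ N : ι → ι → ι → ℤ, ∀ u v x y, u < v → E u v → x < y → E x y →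
      Disjoint (A u v) (A x y) →
      2 * (N u v x - N u v y - N x y u + N x y v) +
        ((if x < v then 1 else -1) - (if x < u then 1 else -1) - (if y < v then 1 else -1) +
          (if y < u then 1 else -1)) = 0 := by
  classical
  have hγ : ∀ i j, ∃ γ : Path (P i) (P j), i < j → E i j → ∀ t, γ t ∈ A i j := by
    intro i j
    by_cases h : i < j ∧ E i j
    · exact ⟨(hA i j h.1 h.2).somePath, fun _ _ ↦ (hA i j h.1 h.2).somePath_mem⟩
    · exact ⟨(PathConnectedSpace.joined _ _).somePath, fun h1 h2 ↦ (h ⟨h1, h2⟩).elim⟩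
  choose γ hγ using hγ
  -- A logarithm of `P i - P j`, with the branch chosen by the order of the indices so that swapping
  -- them costs exactly `±πi`. These signs produce the contribution of the convex reference drawing:
  -- it is `±2` if the chords `u v` and `x y` cross there, and `0` otherwise.
  let c : ι → ι → ℂ := fun i j ↦
    if i < j then Complex.log (P i - P j) else Complex.log (P j - P i) + Real.pi * Complex.I
  have hc : ∀ i j, i ≠ j → Complex.exp (c i j) = P i - P j := by
    intro i j hij
    by_cases h : i < j
    · simp only [c, if_pos h]
      exact Complex.exp_log (sub_ne_zero.2 (hP.ne hij))
    · simp only [c, if_neg h]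
      rw [Complex.exp_add, Complex.exp_pi_mul_I, Complex.exp_log (sub_ne_zero.2 (hP.ne hij.symm))]
      ring
  have hcs : ∀ i j, i ≠ j →
      c i j - c j i = ((if j < i then 1 else -1 : ℤ) : ℂ) * (Real.pi * Complex.I) := by
    intro i j hij
    rcases lt_or_gt_of_ne hij with h | h
    · simp [c, h, h.not_gt]
    · simp [c, h, h.not_gt]
  have hN : ∀ i j k, ∃ n : ℤ, k ≠ i → k ≠ j → (∀ t, γ i j t ≠ P k) →
      logIncrement (γ i j) (P k) = c j k - c i k + n * (2 * Real.pi * Complex.I) := by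
    intro i j k
    by_cases h : k ≠ i ∧ k ≠ j ∧ ∀ t, γ i j t ≠ P k
    · have h1 := exp_logIncrement (γ i j) (P k) h.2.2
      have h2 : Complex.exp (logIncrement (γ i j) (P k)) = Complex.exp (c j k - c i k) := by
        rw [Complex.exp_sub, hc j k h.2.1.symm, hc i k h.1.symm, eq_div_iff
          (sub_ne_zero.2 (hP.ne h.1.symm)), h1]
      obtain ⟨n, hn⟩ := Complex.exp_eq_exp_iff_exists_int.1 h2
      exact ⟨n, fun _ _ _ ↦ hn⟩
    · exact ⟨0, fun h1 h2 h3 ↦ (h ⟨h1, h2, h3⟩).elim⟩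
  choose N hN using hN
  refine ⟨N, fun u v x y huv hE hxy hE' hd ↦ ?_⟩
  have hdis : ∀ s t, γ u v s ≠ γ x y t := fun s t ↦
    hd.ne_of_mem (hγ u v huv hE s) (hγ x y hxy hE' t)
  have ex : ∀ s, γ u v s ≠ P x := fun s ↦ by simpa using hdis s 0
  have ey : ∀ s, γ u v s ≠ P y := fun s ↦ by simpa using hdis s 1
  have eu : ∀ t, γ x y t ≠ P u := fun t ↦ by simpa using (hdis 0 t).symm
  have ev : ∀ t, γ x y t ≠ P v := fun t ↦ by simpa using (hdis 1 t).symm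
  have xu : x ≠ u := fun h ↦ ex 0 (by simp [h])
  have xv : x ≠ v := fun h ↦ ex 1 (by simp [h])
  have yu : y ≠ u := fun h ↦ ey 0 (by simp [h])
  have yv : y ≠ v := fun h ↦ ey 1 (by simp [h])
  have key := logIncrement_add_eq (γ u v) (γ x y) hdis
  rw [hN u v x xu xv ex, hN u v y yu yv ey, hN x y u xu.symm yu.symm eu,
    hN x y v xv.symm yv.symm ev] at key
  have h1 := hcs v x xv.symm
  have h2 := hcs u x xu.symm
  have h3 := hcs v y yv.symm
  have h4 := hcs u y yu.symm
  have hpi : (Real.pi * Complex.I : ℂ) ≠ 0 := by simp [Real.pi_ne_zero]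
  have : ((2 * (N u v x - N u v y - N x y u + N x y v) +
        ((if x < v then 1 else -1) - (if x < u then 1 else -1) - (if y < v then 1 else -1) +
          (if y < u then 1 else -1)) : ℤ) : ℂ) * (Real.pi * Complex.I) = 0 := by
    push_cast at h1 h2 h3 h4 ⊢
    linear_combination key - h1 + h2 + h3 - h4
  exact_mod_cast (mul_eq_zero.1 this).resolve_right hpi

/-- `K₃,₃` has no drawing in which disjoint edges do not meet. -/
theorem not_drawing_completeBipartite (p q : Fin 3 → ℂ) (hp : Function.Injective p)
    (hq : Function.Injective q) (hpq : ∀ i k, p i ≠ q k) (A : Fin 3 → Fin 3 → Set ℂ)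
    (hA : ∀ i k, JoinedIn (A i k) (p i) (q k))
    (hd : ∀ i j k l, i ≠ j → k ≠ l → Disjoint (A i k) (A j l)) : False := by
  have hP : Function.Injective ![p 0, p 1, p 2, q 0, q 1, q 2] := by
    have h01 := hp.ne (show (0 : Fin 3) ≠ 1 by decide)
    have h02 := hp.ne (show (0 : Fin 3) ≠ 2 by decide)
    have h12 := hp.ne (show (1 : Fin 3) ≠ 2 by decide)
    have k01 := hq.ne (show (0 : Fin 3) ≠ 1 by decide)
    have k02 := hq.ne (show (0 : Fin 3) ≠ 2 by decide)
    have k12 := hq.ne (show (1 : Fin 3) ≠ 2 by decide)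
    rw [← List.nodup_ofFn]
    simp [h01, h02, h12, k01, k02, k12, hpq]
  let l : Fin 6 → Fin 3 := ![0, 1, 2, 0, 0, 0]
  let r : Fin 6 → Fin 3 := ![0, 0, 0, 0, 1, 2]
  obtain ⟨N, hN⟩ := exists_vanKampen_relation _ hP (fun i j ↦ i < 3 ∧ 3 ≤ j)
    (fun i j ↦ A (l i) (r j)) (by
      intro i j _ hE
      fin_cases i <;> fin_cases j <;> first | exact hA _ _ | (exfalso; revert hE; decide))
  have h : ∀ u v x y : Fin 6, u < 3 → 3 ≤ v → x < 3 → 3 ≤ y → l u ≠ l x → r v ≠ r y →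
      2 * (N u v x - N u v y - N x y u + N x y v) +
        ((if x < v then 1 else -1) - (if x < u then 1 else -1) - (if y < v then 1 else -1) +
          (if y < u then 1 else -1)) = 0 := fun u v x y hu hv hx hy h1 h2 ↦
    hN u v x y (hu.trans_le hv) ⟨hu, hv⟩ (hx.trans_le hy) ⟨hx, hy⟩ (hd _ _ _ _ h1 h2)
  -- These are all eighteen pairs of disjoint edges. Each `N u v x` that occurs does so in exactly
  -- two relations, while nine of the pairs cross in the convex drawing. Halving and adding the
  -- relations equates an even number with an odd one.
  have e1 := h 0 3 1 4 (by decide) (by decide) (by decide) (by decide) (by decide) (by decide)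
  have e2 := h 0 3 1 5 (by decide) (by decide) (by decide) (by decide) (by decide) (by decide)
  have e3 := h 0 3 2 4 (by decide) (by decide) (by decide) (by decide) (by decide) (by decide)
  have e4 := h 0 3 2 5 (by decide) (by decide) (by decide) (by decide) (by decide) (by decide)
  have e5 := h 0 4 1 3 (by decide) (by decide) (by decide) (by decide) (by decide) (by decide)
  have e6 := h 0 4 1 5 (by decide) (by decide) (by decide) (by decide) (by decide) (by decide)
  have e7 := h 0 4 2 3 (by decide) (by decide) (by decide) (by decide) (by decide) (by decide)
  have e8 := h 0 4 2 5 (by decide) (by decide) (by decide) (by decide) (by decide) (by decide)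
  have e9 := h 0 5 1 3 (by decide) (by decide) (by decide) (by decide) (by decide) (by decide)
  have e10 := h 0 5 1 4 (by decide) (by decide) (by decide) (by decide) (by decide) (by decide)
  have e11 := h 0 5 2 3 (by decide) (by decide) (by decide) (by decide) (by decide) (by decide)
  have e12 := h 0 5 2 4 (by decide) (by decide) (by decide) (by decide) (by decide) (by decide)
  have e13 := h 1 3 2 4 (by decide) (by decide) (by decide) (by decide) (by decide) (by decide)
  have e14 := h 1 3 2 5 (by decide) (by decide) (by decide) (by decide) (by decide) (by decide)
  have e15 := h 1 4 2 3 (by decide) (by decide) (by decide) (by decide) (by decide) (by decide)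
  have e16 := h 1 4 2 5 (by decide) (by decide) (by decide) (by decide) (by decide) (by decide)
  have e17 := h 1 5 2 3 (by decide) (by decide) (by decide) (by decide) (by decide) (by decide)
  have e18 := h 1 5 2 4 (by decide) (by decide) (by decide) (by decide) (by decide) (by decide)
  clear h hN hA hd
  simp +decide only [if_true, if_false] at *
  omega

/-- `K₅` has no drawing in which disjoint edges do not meet. -/
theorem not_drawing_completeGraph_five (P : Fin 5 → ℂ) (hP : Function.Injective P)
    (A : Fin 5 → Fin 5 → Set ℂ) (hA : ∀ i j, i < j → JoinedIn (A i j) (P i) (P j))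
    (hd : ∀ e ∈ ([
      (0, 1, 2, 3), (0, 1, 2, 4), (0, 1, 3, 4), (0, 2, 1, 3), (0, 2, 1, 4), (0, 2, 3, 4),
      (0, 3, 1, 2), (0, 3, 1, 4), (0, 3, 2, 4), (0, 4, 1, 2), (0, 4, 1, 3), (0, 4, 2, 3),
      (1, 2, 3, 4), (1, 3, 2, 4), (1, 4, 2, 3)] :
      List (Fin 5 × Fin 5 × Fin 5 × Fin 5)), Disjoint (A e.1 e.2.1) (A e.2.2.1 e.2.2.2)) :
    False := by
  obtain ⟨N, hN⟩ := exists_vanKampen_relation _ hP (fun i j ↦ True) A (fun i j h _ ↦ hA i j h)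
  -- Again each `N u v x` occurs in two of the fifteen relations, and five pairs of diagonals of the
  -- convex pentagon cross, so the parities clash.
  have e1 := hN 0 1 2 3 (by decide) trivial (by decide) trivial (hd (0, 1, 2, 3) (by decide))
  have e2 := hN 0 1 2 4 (by decide) trivial (by decide) trivial (hd (0, 1, 2, 4) (by decide))
  have e3 := hN 0 1 3 4 (by decide) trivial (by decide) trivial (hd (0, 1, 3, 4) (by decide))
  have e4 := hN 0 2 1 3 (by decide) trivial (by decide) trivial (hd (0, 2, 1, 3) (by decide))
  have e5 := hN 0 2 1 4 (by decide) trivial (by decide) trivial (hd (0, 2, 1, 4) (by decide))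
  have e6 := hN 0 2 3 4 (by decide) trivial (by decide) trivial (hd (0, 2, 3, 4) (by decide))
  have e7 := hN 0 3 1 2 (by decide) trivial (by decide) trivial (hd (0, 3, 1, 2) (by decide))
  have e8 := hN 0 3 1 4 (by decide) trivial (by decide) trivial (hd (0, 3, 1, 4) (by decide))
  have e9 := hN 0 3 2 4 (by decide) trivial (by decide) trivial (hd (0, 3, 2, 4) (by decide))
  have e10 := hN 0 4 1 2 (by decide) trivial (by decide) trivial (hd (0, 4, 1, 2) (by decide))
  have e11 := hN 0 4 1 3 (by decide) trivial (by decide) trivial (hd (0, 4, 1, 3) (by decide))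
  have e12 := hN 0 4 2 3 (by decide) trivial (by decide) trivial (hd (0, 4, 2, 3) (by decide))
  have e13 := hN 1 2 3 4 (by decide) trivial (by decide) trivial (hd (1, 2, 3, 4) (by decide))
  have e14 := hN 1 3 2 4 (by decide) trivial (by decide) trivial (hd (1, 3, 2, 4) (by decide))
  have e15 := hN 1 4 2 3 (by decide) trivial (by decide) trivial (hd (1, 4, 2, 3) (by decide))
  clear hN hA hd
  simp +decide only [if_true, if_false] at *
  omega

/-! ### Labels on cycles with prescribed ends -/

/-- A sequence of `k` labels interpolates between two ordered pairs of labels if consecutive labels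
are disjoint and labels two apart share exactly one color. -/
def IsLadder (k : ℕ) (c : ℕ → Finset (Fin 11)) (P Q P' Q' : Finset (Fin 11)) : Prop :=
  (c 0 = P ∧ c 1 = Q ∧ c (k + 2) = P' ∧ c (k + 3) = Q') ∧ (∀ i < k + 4, (c i).card = 3) ∧
    (∀ i < k + 3, Disjoint (c i) (c (i + 1))) ∧ ∀ i < k + 2, (c i ∩ c (i + 2)).card = 1

theorem IsLadder.cons {k : ℕ} {c : ℕ → Finset (Fin 11)} {P Q R P' Q' : Finset (Fin 11)}
    (h : IsLadder k c Q R P' Q') (hP : P.card = 3) (hPQ : Disjoint P Q)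
    (hPR : (P ∩ R).card = 1) :
    IsLadder (k + 1) (fun i ↦ Nat.casesOn i P c) P Q P' Q' := by
  obtain ⟨⟨h0, h1, h2, h3⟩, h4, h5, h6⟩ := h
  refine ⟨⟨rfl, h0, h2, h3⟩, ?_, ?_, ?_⟩
  · rintro (_ | i) hi
    · exact hP
    · exact h4 i (by omega)
  · rintro (_ | i) hi
    · simpa [h0] using hPQ
    · exact h5 i (by omega)
  · rintro (_ | i) hi
    · simpa [h1] using hPR
    · exact h6 i (by omega)

theorem isLadder_one {P Q R P' Q' : Finset (Fin 11)}
    (h : (P.card = 3 ∧ Q.card = 3 ∧ R.card = 3 ∧ P'.card = 3 ∧ Q'.card = 3) ∧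
      (Disjoint P Q ∧ Disjoint Q R ∧ Disjoint R P' ∧ Disjoint P' Q') ∧
      (P ∩ R).card = 1 ∧ (Q ∩ P').card = 1 ∧ (R ∩ Q').card = 1) :
    ∃ c, IsLadder 1 c P Q P' Q' := by
  refine ⟨fun i ↦ [P, Q, R, P', Q'].getD i ∅, by simp, ?_, ?_, ?_⟩
  · intro i hi
    interval_cases i <;> simp [h]
  · intro i hi
    interval_cases i <;> simp [h]
  · intro i hi
    interval_cases i <;> simp [h]

theorem isLadder_two {P Q R S P' Q' : Finset (Fin 11)}
    (h : (P.card = 3 ∧ Q.card = 3 ∧ R.card = 3 ∧ S.card = 3 ∧ P'.card = 3 ∧ Q'.card = 3) ∧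
      (Disjoint P Q ∧ Disjoint Q R ∧ Disjoint R S ∧ Disjoint S P' ∧ Disjoint P' Q') ∧
      (P ∩ R).card = 1 ∧ (Q ∩ S).card = 1 ∧ (R ∩ P').card = 1 ∧ (S ∩ Q').card = 1) :
    ∃ c, IsLadder 2 c P Q P' Q' := by
  refine ⟨fun i ↦ [P, Q, R, S, P', Q'].getD i ∅, by simp, ?_, ?_, ?_⟩
  · intro i hi
    interval_cases i <;> simp [h]
  · intro i hi
    interval_cases i <;> simp [h]
  · intro i hi
    interval_cases i <;> simp [h]

/-- The pattern `C` is valid cyclically, so stepping back one place in it lengthens a ladder by one.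
All lengths reduce to length two from each of the four starting positions. -/
theorem exists_isLadder_of_four_cycle {C : Fin 4 → Finset (Fin 11)} {P' Q' : Finset (Fin 11)}
    (hC : ∀ i, (C i).card = 3) (hd : ∀ i, Disjoint (C i) (C (i + 1)))
    (h1 : ∀ i, (C i ∩ C (i + 2)).card = 1)
    (h2 : ∀ i, ∃ c, IsLadder 2 c (C i) (C (i + 1)) P' Q') (k : ℕ) (hk : 2 ≤ k) (i : Fin 4) :
    ∃ c, IsLadder k c (C i) (C (i + 1)) P' Q' := by
  induction k, hk using Nat.le_induction generalizing i with
  | base => exact h2 i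
  | succ k hk ih =>
    obtain ⟨c, hc⟩ := ih (i + 1)
    have : i + 1 + 1 = i + 2 := by rw [add_assoc]; rfl
    exact ⟨_, hc.cons (hC i) (hd i) (by rw [this]; exact h1 i)⟩

/-- Here `{0, 1, 2}` and `{3, 4, 5}` belong to the ends of a chord, `{3, 6, 7}` and `{0, 7, 8}` to
the cycle vertices next to them. The colors `3` and `0` provide the intersections needed when the
ladder closes up to a cycle of length `k + 4`. -/
theorem exists_isLadder_edge (k : ℕ) (hk : 1 ≤ k) :
    ∃ c, IsLadder k c {0, 1, 2} {3, 6, 7} {0, 7, 8} {3, 4, 5} := by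
  obtain rfl | hk := hk.eq_or_lt
  · exact isLadder_one (R := {1, 4, 9}) (by decide)
  refine exists_isLadder_of_four_cycle (C := ![{0, 1, 2}, {3, 6, 7}, {0, 8, 9}, {3, 4, 5}])
    (by decide) (by decide) (by decide) (fun i ↦ ?_) k hk 0
  fin_cases i
  · exact isLadder_two (R := {0, 4, 5}) (S := {1, 2, 3}) (by decide)
  · exact isLadder_two (R := {1, 2, 7}) (S := {3, 6, 9}) (by decide)
  · exact isLadder_two (R := {0, 1, 2}) (S := {3, 6, 9}) (by decide)
  · exact isLadder_two (R := {3, 6, 7}) (S := {1, 4, 9}) (by decide)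

/-- The final `{0, 1, 2}` is the initial label again, so the ladder wraps around to a cycle of
length `k + 3`. The two labels next to it share exactly `3`, which is also the color they share with
the label `{3, 4, 5}` of the neighbor off the cycle. -/
theorem exists_isLadder_vertex (k : ℕ) (hk : 1 ≤ k) :
    ∃ c, IsLadder k c {0, 1, 2} {3, 6, 7} {3, 8, 9} {0, 1, 2} := by
  obtain rfl | hk := hk.eq_or_lt
  · exact isLadder_one (R := {0, 4, 5}) (by decide)
  refine exists_isLadder_of_four_cycle (C := ![{0, 1, 2}, {3, 6, 7}, {0, 8, 9}, {3, 4, 5}])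
    (by decide) (by decide) (by decide) (fun i ↦ ?_) k hk 0
  fin_cases i
  · exact isLadder_two (R := {0, 4, 8}) (S := {1, 5, 6}) (by decide)
  · exact isLadder_two (R := {1, 2, 3}) (S := {0, 4, 5}) (by decide)
  · exact isLadder_two (R := {1, 2, 8}) (S := {0, 4, 6}) (by decide)
  · exact isLadder_two (R := {3, 6, 7}) (S := {0, 4, 5}) (by decide)

/-- `c 0, …, c (n - 1)` is a 3-good coloring of a cycle of length `n`. -/
def IsCycleColoring (n : ℕ) (c : ℕ → Finset (Fin 11)) : Prop :=
  (∀ i < n, (c i).card = 3) ∧ (∀ i, i + 1 < n → Disjoint (c i) (c (i + 1))) ∧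
    Disjoint (c 0) (c (n - 1)) ∧
    (4 ≤ n → (∀ i, i + 2 < n → (c i ∩ c (i + 2)).card = 1) ∧ (c 0 ∩ c (n - 2)).card = 1 ∧
      (c 1 ∩ c (n - 1)).card = 1)

theorem IsCycleColoring.map {n : ℕ} {c : ℕ → Finset (Fin 11)} (h : IsCycleColoring n c)
    (σ : Equiv.Perm (Fin 11)) : IsCycleColoring n fun i ↦ (c i).map σ.toEmbedding := by
  simpa only [IsCycleColoring, Finset.card_map, Finset.disjoint_map, ← Finset.map_inter] using h

/-- Families of disjoint sets with the same cardinalities are related by a permutation. -/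
theorem exists_perm_map_eq {k : ℕ} (S T : Fin k → Finset (Fin 11))
    (hS : ∀ i j, i ≠ j → Disjoint (S i) (S j)) (hT : ∀ i j, i ≠ j → Disjoint (T i) (T j))
    (hc : ∀ i, (T i).card = (S i).card) :
    ∃ σ : Equiv.Perm (Fin 11), ∀ i, (T i).map σ.toEmbedding = S i := by
  classical
  let e : ∀ i, T i ≃ S i := fun i ↦ Finset.equivOfCardEq (hc i)
  have hiT : Function.Injective fun x : Σ i, T i ↦ (x.2 : Fin 11) := by
    rintro ⟨i, x⟩ ⟨j, y⟩ h
    obtain rfl : i = j := by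
      by_contra hij
      refine Finset.disjoint_left.1 (hT i j hij) x.2 ?_
      rw [show (x : Fin 11) = y from h]
      exact y.2
    rw [show x = y from Subtype.ext h]
  have hiS : Function.Injective fun x : Σ i, T i ↦ (e x.1 x.2 : Fin 11) := by
    rintro ⟨i, x⟩ ⟨j, y⟩ h
    obtain rfl : i = j := by
      by_contra hij
      refine Finset.disjoint_left.1 (hS i j hij) (e i x).2 ?_
      rw [show (e i x : Fin 11) = e j y from h]
      exact (e j y).2
    rw [show x = y from (e i).injective (Subtype.ext h)]
  obtain ⟨σ, hσ⟩ := Equiv.Perm.exists_extending_pair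
    (fun x : Σ i, T i ↦ (x.2 : Fin 11)) (fun x ↦ (e x.1 x.2 : Fin 11)) hiT hiS
  refine ⟨σ, fun i ↦ ?_⟩
  ext y
  simp only [Finset.mem_map_equiv]
  constructor
  · intro h
    have := hσ ⟨i, ⟨σ.symm y, h⟩⟩
    simp only [Equiv.apply_symm_apply] at this
    rw [this]
    exact (e i _).2
  · intro h
    have := hσ ⟨i, (e i).symm ⟨y, h⟩⟩
    simp only [Equiv.apply_symm_apply] at this
    rw [← this, Equiv.symm_apply_apply]
    exact ((e i).symm ⟨y, h⟩).2

/-- `A` and `B` are the labels of the neighbors off the cycle of the two chord ends. With one or two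
new vertices the labels depend on `A` and `B` and are supplied by `h1` and `h2`. From three on, the
new labels next to the ends are always `{3, 6, 7}` and `{0, 7, 8}`, and a ladder fills the gap. -/
theorem exists_chord_coloring_aux {A B : Finset (Fin 11)}
    (h1 : ∃ U : Finset (Fin 11), U.card = 3 ∧ Disjoint {0, 1, 2} U ∧ Disjoint U {3, 4, 5} ∧
      (U ∩ A).card = 1 ∧ (U ∩ B).card = 1)
    (h2 : ∃ U W : Finset (Fin 11), (U.card = 3 ∧ W.card = 3) ∧
      (Disjoint {0, 1, 2} U ∧ Disjoint U W ∧ Disjoint W {3, 4, 5}) ∧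
      (({0, 1, 2} ∩ W).card = 1 ∧ (U ∩ {3, 4, 5}).card = 1) ∧
      (U ∩ A).card = 1 ∧ (W ∩ B).card = 1)
    (hA : ({3, 6, 7} ∩ A).card = 1) (hB : ({0, 7, 8} ∩ B).card = 1) (m : ℕ) (hm : 1 ≤ m) :
    ∃ c, IsCycleColoring (m + 2) c ∧ c 0 = {0, 1, 2} ∧ c (m + 1) = {3, 4, 5} ∧
      (c 1 ∩ A).card = 1 ∧ (c m ∩ B).card = 1 := by
  obtain rfl | hm := hm.eq_or_lt
  · obtain ⟨U, hU, hXU, hUY, hUA, hUB⟩ := h1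
    refine ⟨fun i ↦ [{0, 1, 2}, U, {3, 4, 5}].getD i ∅, ⟨?_, ?_, ?_, by omega⟩, rfl, rfl, hUA, hUB⟩
    · intro i hi
      interval_cases i <;> simp [hU]
    · intro i hi
      have : i < 2 := by omega
      interval_cases i
      · exact hXU
      · exact hUY
    · change Disjoint ({0, 1, 2} : Finset (Fin 11)) {3, 4, 5}
      decide
  obtain rfl | hm := (Nat.succ_le_iff.2 hm).eq_or_lt
  · obtain ⟨U, W, ⟨hU, hW⟩, ⟨hXU, hUW, hWY⟩, ⟨hXW, hUY⟩, hUA, hWB⟩ := h2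
    refine ⟨fun i ↦ [{0, 1, 2}, U, W, {3, 4, 5}].getD i ∅, ⟨?_, ?_, ?_, fun _ ↦ ⟨?_, hXW, hUY⟩⟩,
      rfl, rfl, hUA, hWB⟩
    · intro i hi
      interval_cases i <;> simp [hU, hW]
    · intro i hi
      have : i < 3 := by omega
      interval_cases i
      · exact hXU
      · exact hUW
      · exact hWY
    · change Disjoint ({0, 1, 2} : Finset (Fin 11)) {3, 4, 5}
      decide
    · intro i hi
      have : i < 2 := by omega
      interval_cases i
      · exact hXW
      · exact hUY
  obtain ⟨k, rfl⟩ : ∃ k, m = k + 2 := ⟨m - 2, by omega⟩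
  obtain ⟨c, ⟨c0, c1, c2, c3⟩, h4, h5, h6⟩ := exists_isLadder_edge k (by omega)
  refine ⟨c, ⟨h4, fun i hi ↦ h5 i (by omega), ?_, fun _ ↦ ⟨fun i hi ↦ h6 i (by omega), ?_, ?_⟩⟩,
    c0, c3, by rw [c1, hA], by rw [c2, hB]⟩
  · change Disjoint (c 0) (c (k + 3))
    rw [c0, c3]
    decide
  · change (c 0 ∩ c (k + 2)).card = 1
    rw [c0, c2]
    decide
  · change (c 1 ∩ c (k + 3)).card = 1
    rw [c1, c3]
    decide

theorem exists_chord_coloring_map {A B : Finset (Fin 11)} (σ : Equiv.Perm (Fin 11)) {m : ℕ}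
    (h : ∃ c, IsCycleColoring (m + 2) c ∧ c 0 = {0, 1, 2} ∧ c (m + 1) = {3, 4, 5} ∧
      (c 1 ∩ A).card = 1 ∧ (c m ∩ B).card = 1) :
    ∃ c, IsCycleColoring (m + 2) c ∧ c 0 = Finset.map σ.toEmbedding {0, 1, 2} ∧
      c (m + 1) = Finset.map σ.toEmbedding {3, 4, 5} ∧
      (c 1 ∩ A.map σ.toEmbedding).card = 1 ∧ (c m ∩ B.map σ.toEmbedding).card = 1 := by
  obtain ⟨c, hc, h0, h1, h2, h3⟩ := h
  refine ⟨_, hc.map σ, by simp only [h0], by simp only [h1], ?_, ?_⟩ <;>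
    simpa only [← Finset.map_inter, Finset.card_map]

/-- The case in which the chord ends have a common neighbor: three pairwise disjoint labels are
unique up to a permutation of the colors. -/
theorem exists_chord_coloring_of_eq {X Y A : Finset (Fin 11)} (hX : X.card = 3) (hY : Y.card = 3)
    (hA : A.card = 3) (hXY : Disjoint X Y) (hXA : Disjoint X A) (hYA : Disjoint Y A) (m : ℕ)
    (hm : 1 ≤ m) :
    ∃ c, IsCycleColoring (m + 2) c ∧ c 0 = X ∧ c (m + 1) = Y ∧
      (c 1 ∩ A).card = 1 ∧ (c m ∩ A).card = 1 := by
  obtain ⟨σ, hσ⟩ := exists_perm_map_eq ![X, Y, A] ![{0, 1, 2}, {3, 4, 5}, {7, 9, 10}]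
    (by
      intro i j hij
      fin_cases i <;> fin_cases j <;>
        first | exact absurd rfl hij | assumption | (apply Disjoint.symm; assumption))
    (by decide)
    (by intro i; fin_cases i <;> simp [hX, hY, hA])
  have h0 := hσ 0
  have h1 := hσ 1
  have h2 := hσ 2
  simp only [Matrix.cons_val] at h0 h1 h2
  rw [← h0, ← h1, ← h2]
  exact exists_chord_coloring_map σ (exists_chord_coloring_aux
    ⟨{6, 7, 8}, by decide⟩ ⟨{3, 6, 7}, {0, 8, 9}, by decide⟩ (by decide) (by decide) m hm)

/-- The case without a common neighbor. The seven cells of the Venn diagram of `X`, `Y`, `A`, `B`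
have sizes determined by `(A ∩ B).card`, which is at most two because the color of `A` in `Y` is not
in `B`. So three normal forms suffice. -/
theorem exists_chord_coloring_of_ne {X Y A B : Finset (Fin 11)} (hX : X.card = 3)
    (hY : Y.card = 3) (hA : A.card = 3) (hB : B.card = 3) (hXY : Disjoint X Y)
    (hXA : Disjoint X A) (hYB : Disjoint Y B) (hAY : (A ∩ Y).card = 1) (hBX : (B ∩ X).card = 1)
    (m : ℕ) (hm : 1 ≤ m) :
    ∃ c, IsCycleColoring (m + 2) c ∧ c 0 = X ∧ c (m + 1) = Y ∧
      (c 1 ∩ A).card = 1 ∧ (c m ∩ B).card = 1 := by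
  have eX : X = B ∩ X ∪ X \ B := by grind
  have eY : Y = A ∩ Y ∪ Y \ A := by grind
  have eA : A = A ∩ Y ∪ (A ∩ B ∪ A \ (B ∪ Y)) := by grind
  have eB : B = B ∩ X ∪ (A ∩ B ∪ B \ (A ∪ X)) := by
    have := Finset.disjoint_left.1 hXA
    grind
  have dX : Disjoint (B ∩ X) (X \ B) := by grind [Finset.disjoint_left]
  have dY : Disjoint (A ∩ Y) (Y \ A) := by grind [Finset.disjoint_left]
  have dA : Disjoint (A ∩ Y) (A ∩ B ∪ A \ (B ∪ Y)) := by grind [Finset.disjoint_left]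
  have dA' : Disjoint (A ∩ B) (A \ (B ∪ Y)) := by grind [Finset.disjoint_left]
  have dB : Disjoint (B ∩ X) (A ∩ B ∪ B \ (A ∪ X)) := by grind [Finset.disjoint_left]
  have dB' : Disjoint (A ∩ B) (B \ (A ∪ X)) := by grind [Finset.disjoint_left]
  have cX := congrArg Finset.card eX
  have cY := congrArg Finset.card eY
  have cA := congrArg Finset.card eA
  have cB := congrArg Finset.card eB
  rw [Finset.card_union_of_disjoint dX] at cX
  rw [Finset.card_union_of_disjoint dY] at cY
  rw [Finset.card_union_of_disjoint dA, Finset.card_union_of_disjoint dA'] at cA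
  rw [Finset.card_union_of_disjoint dB, Finset.card_union_of_disjoint dB'] at cB
  have hS : ∀ i j : Fin 7, i ≠ j →
      Disjoint (![B ∩ X, X \ B, A ∩ Y, Y \ A, A ∩ B, A \ (B ∪ Y), B \ (A ∪ X)] i)
        (![B ∩ X, X \ B, A ∩ Y, Y \ A, A ∩ B, A \ (B ∪ Y), B \ (A ∪ X)] j) := by
    have key : ∀ i j : Fin 7, i < j →
        Disjoint (![B ∩ X, X \ B, A ∩ Y, Y \ A, A ∩ B, A \ (B ∪ Y), B \ (A ∪ X)] i)
          (![B ∩ X, X \ B, A ∩ Y, Y \ A, A ∩ B, A \ (B ∪ Y), B \ (A ∪ X)] j) := by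
      intro i j hij
      rw [Finset.disjoint_left] at *
      fin_cases i <;> fin_cases j <;>
        first | exact absurd hij (by decide) | (simp; grind)
    intro i j hij
    rcases lt_or_gt_of_ne hij with h | h
    · exact key i j h
    · exact (key j i h).symm
  have main : ∀ A₀ B₀ : Finset (Fin 11),
      (∀ i j : Fin 7, i ≠ j → Disjoint
        (![{0}, {1, 2}, {3}, {4, 5}, A₀ ∩ B₀, A₀ \ insert 3 B₀, B₀ \ insert 0 A₀] i)
        (![{0}, {1, 2}, {3}, {4, 5}, A₀ ∩ B₀, A₀ \ insert 3 B₀, B₀ \ insert 0 A₀] j)) →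
      (A₀ ∩ B₀).card = (A ∩ B).card → (A₀ \ insert 3 B₀).card = 2 - (A ∩ B).card →
      (B₀ \ insert 0 A₀).card = 2 - (A ∩ B).card →
      {3} ∪ (A₀ ∩ B₀ ∪ A₀ \ insert 3 B₀) = A₀ → {0} ∪ (A₀ ∩ B₀ ∪ B₀ \ insert 0 A₀) = B₀ →
      ∃ σ : Equiv.Perm (Fin 11), Finset.map σ.toEmbedding {0, 1, 2} = X ∧
        Finset.map σ.toEmbedding {3, 4, 5} = Y ∧ A₀.map σ.toEmbedding = A ∧
        B₀.map σ.toEmbedding = B := by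
    intro A₀ B₀ hd c1 c2 c3 e1 e2
    obtain ⟨σ, hσ⟩ := exists_perm_map_eq _ _ hS hd (by
      intro i
      fin_cases i
      · simp [hBX]
      · change ({1, 2} : Finset (Fin 11)).card = (X \ B).card
        rw [show ({1, 2} : Finset (Fin 11)).card = 2 from rfl]
        omega
      · simp [hAY]
      · change ({4, 5} : Finset (Fin 11)).card = (Y \ A).card
        rw [show ({4, 5} : Finset (Fin 11)).card = 2 from rfl]
        omega
      · exact c1
      · exact c2.trans (by change _ = (A \ (B ∪ Y)).card; omega)
      · exact c3.trans (by change _ = (B \ (A ∪ X)).card; omega))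
    have h0 := hσ 0
    have h1 := hσ 1
    have h2 := hσ 2
    have h3 := hσ 3
    have h4 := hσ 4
    have h5 := hσ 5
    have h6 := hσ 6
    simp only [Matrix.cons_val] at h0 h1 h2 h3 h4 h5 h6
    refine ⟨σ, ?_, ?_, ?_, ?_⟩
    · rw [show ({0, 1, 2} : Finset (Fin 11)) = {0} ∪ {1, 2} from rfl, Finset.map_union, h0, h1,
        ← eX]
    · rw [show ({3, 4, 5} : Finset (Fin 11)) = {3} ∪ {4, 5} from rfl, Finset.map_union, h2, h3,
        ← eY]
    · rw [← e1, Finset.map_union, Finset.map_union, h2, h4, h5, ← eA]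
    · rw [← e2, Finset.map_union, Finset.map_union, h0, h4, h6, ← eB]
  have hle : (A ∩ B).card = 0 ∨ (A ∩ B).card = 1 ∨ (A ∩ B).card = 2 := by omega
  rcases hle with h | h | h <;> rw [h] at main
  · obtain ⟨σ, rfl, rfl, rfl, rfl⟩ := main {3, 8, 9} {0, 6, 10} (by decide) (by decide)
      (by decide) (by decide) (by decide) (by decide)
    exact exists_chord_coloring_map σ (exists_chord_coloring_aux
      ⟨{8, 6, 7}, by decide⟩ ⟨{3, 6, 7}, {0, 8, 9}, by decide⟩ (by decide) (by decide) m hm)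
  · obtain ⟨σ, rfl, rfl, rfl, rfl⟩ := main {3, 8, 9} {0, 9, 10} (by decide) (by decide)
      (by decide) (by decide) (by decide) (by decide)
    exact exists_chord_coloring_map σ (exists_chord_coloring_aux
      ⟨{9, 6, 7}, by decide⟩ ⟨{3, 6, 10}, {0, 7, 8}, by decide⟩ (by decide) (by decide) m hm)
  · obtain ⟨σ, rfl, rfl, rfl, rfl⟩ := main {3, 9, 10} {0, 9, 10} (by decide) (by decide)
      (by decide) (by decide) (by decide) (by decide)
    exact exists_chord_coloring_map σ (exists_chord_coloring_aux
      ⟨{9, 6, 7}, by decide⟩ ⟨{4, 6, 9}, {0, 7, 8}, by decide⟩ (by decide) (by decide) m hm)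

/-- A cycle `r, p₁, …, p_m` hanging from a vertex with label `Z` at `r` can be colored. -/
theorem exists_pendant_cycle_coloring {R Z : Finset (Fin 11)} (hR : R.card = 3)
    (hZ : Z.card = 3) (hRZ : Disjoint R Z) (m : ℕ) (hm : 2 ≤ m) :
    ∃ c, IsCycleColoring (m + 1) c ∧ c 0 = R ∧ (c 1 ∩ Z).card = 1 ∧ (c m ∩ Z).card = 1 := by
  obtain ⟨σ, hσ⟩ := exists_perm_map_eq ![R, Z] ![{0, 1, 2}, {3, 4, 5}]
    (by
      intro i j hij
      fin_cases i <;> fin_cases j <;>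
        first | exact absurd rfl hij | assumption | (apply Disjoint.symm; assumption))
    (by decide)
    (by intro i; fin_cases i <;> simp [hR, hZ])
  have h0 := hσ 0
  have h1 := hσ 1
  simp only [Matrix.cons_val] at h0 h1
  rw [← h0, ← h1]
  suffices h : ∃ c, IsCycleColoring (m + 1) c ∧ c 0 = {0, 1, 2} ∧
      (c 1 ∩ {3, 4, 5}).card = 1 ∧ (c m ∩ {3, 4, 5}).card = 1 by
    obtain ⟨c, hc, h0, h2, h3⟩ := h
    refine ⟨_, hc.map σ, by simp only [h0], ?_, ?_⟩ <;>
      simpa only [← Finset.map_inter, Finset.card_map]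
  obtain rfl | hm := hm.eq_or_lt
  -- In a triangle the two new labels must be disjoint, so they meet `{3, 4, 5}` in different
  -- colors.
  · refine ⟨fun i ↦ [{0, 1, 2}, {3, 6, 7}, {4, 8, 9}].getD i ∅, ⟨?_, ?_, ?_, by omega⟩, rfl, ?_, ?_⟩
    · decide
    · intro i hi
      have : i < 2 := by omega
      clear hi
      revert i
      decide
    · decide
    · decide
    · decide
  obtain ⟨k, rfl⟩ : ∃ k, m = k + 2 := ⟨m - 2, by omega⟩
  obtain ⟨c, ⟨c0, c1, c2, c3⟩, h4, h5, h6⟩ := exists_isLadder_vertex k (by omega)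
  refine ⟨c, ⟨fun i hi ↦ h4 i (by omega), fun i hi ↦ h5 i (by omega), ?_,
    fun _ ↦ ⟨fun i hi ↦ h6 i (by omega), ?_, ?_⟩⟩, c0, by rw [c1]; decide, by rw [c2]; decide⟩
  · change Disjoint (c 0) (c (k + 2))
    rw [c0, c2]
    decide
  · change (c 0 ∩ c (k + 1)).card = 1
    have := h6 (k + 1) (by omega)
    rw [c3] at this
    rw [c0, Finset.inter_comm]
    exact this
  · change (c 1 ∩ c (k + 2)).card = 1
    rw [c1, c2]
    decide

/-- A label for a vertex whose only colored neighbor has label `Z`, the other neighbors of that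
one having labels `A` and `B`. -/
theorem exists_pendant_label {Z A B : Finset (Fin 11)} (hZ : Z.card = 3) (hA : A.card = 3)
    (hB : B.card = 3) (hZA : Disjoint Z A) (hZB : Disjoint Z B)
    (h : A = B ∨ Disjoint A B ∨ (A ∩ B).card = 1) :
    ∃ R : Finset (Fin 11), R.card = 3 ∧ Disjoint R Z ∧ (R ∩ A).card = 1 ∧ (R ∩ B).card = 1 := by
  rcases h with rfl | h | h
  · obtain ⟨σ, hσ⟩ := exists_perm_map_eq ![Z, A] ![{0, 1, 2}, {3, 4, 5}]
      (by
        intro i j hij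
        fin_cases i <;> fin_cases j <;>
          first | exact absurd rfl hij | assumption | (apply Disjoint.symm; assumption))
      (by decide) (by intro i; fin_cases i <;> simp [hA, hZ])
    have h0 := hσ 0
    have h1 := hσ 1
    simp only [Matrix.cons_val] at h0 h1
    refine ⟨Finset.map σ.toEmbedding {3, 6, 7}, ?_⟩
    rw [← h0, ← h1]
    simp only [← Finset.map_inter, Finset.card_map, Finset.disjoint_map]
    decide
  · obtain ⟨σ, hσ⟩ := exists_perm_map_eq ![Z, A, B] ![{0, 1, 2}, {3, 4, 5}, {6, 7, 8}]
      (by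
        intro i j hij
        fin_cases i <;> fin_cases j <;>
          first | exact absurd rfl hij | assumption | (apply Disjoint.symm; assumption))
      (by decide) (by intro i; fin_cases i <;> simp [hA, hZ, hB])
    have h0 := hσ 0
    have h1 := hσ 1
    have h2 := hσ 2
    simp only [Matrix.cons_val] at h0 h1 h2
    refine ⟨Finset.map σ.toEmbedding {3, 6, 9}, ?_⟩
    rw [← h0, ← h1, ← h2]
    simp only [← Finset.map_inter, Finset.card_map, Finset.disjoint_map]
    decide
  · have cA := Finset.card_sdiff_add_card_inter A B
    have cB := Finset.card_sdiff_add_card_inter B A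
    rw [Finset.inter_comm] at cB
    obtain ⟨σ, hσ⟩ := exists_perm_map_eq ![Z, A ∩ B, A \ B, B \ A] ![{0, 1, 2}, {3}, {4, 5}, {6, 7}]
      (by
        have key : ∀ i j : Fin 4, i < j → Disjoint (![Z, A ∩ B, A \ B, B \ A] i)
            (![Z, A ∩ B, A \ B, B \ A] j) := by
          intro i j hij
          rw [Finset.disjoint_left] at *
          fin_cases i <;> fin_cases j <;>
            first | exact absurd hij (by decide) | (simp; grind)
        intro i j hij
        rcases lt_or_gt_of_ne hij with h | h
        · exact key i j h
        · exact (key j i h).symm)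
      (by decide)
      (by
        intro i
        fin_cases i
        · simp [hZ]
        · simp [h]
        · change 2 = (A \ B).card
          omega
        · change 2 = (B \ A).card
          omega)
    have h0 := hσ 0
    have h1 := hσ 1
    have h2 := hσ 2
    have h3 := hσ 3
    simp only [Matrix.cons_val] at h0 h1 h2 h3
    have eA : Finset.map σ.toEmbedding {3, 4, 5} = A := by
      rw [show ({3, 4, 5} : Finset (Fin 11)) = {3} ∪ {4, 5} from rfl, Finset.map_union, h1, h2]
      grind
    have eB : Finset.map σ.toEmbedding {3, 6, 7} = B := by
      rw [show ({3, 6, 7} : Finset (Fin 11)) = {3} ∪ {6, 7} from rfl, Finset.map_union, h1, h3]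
      grind
    refine ⟨Finset.map σ.toEmbedding {3, 8, 9}, ?_⟩
    rw [← h0, ← eA, ← eB]
    simp only [← Finset.map_inter, Finset.card_map, Finset.disjoint_map]
    decide

/-! ### Drawings of induced subgraphs and access from a face -/

/-- `u` and `v` are joined by a walk all of whose vertices lie in `s`. -/
def SimpleGraph.JoinedOn {V : Type*} (G : SimpleGraph V) (s : Set V) (u v : V) : Prop :=
  ∃ W : G.Walk u v, ∀ z ∈ W.support, z ∈ s

namespace SimpleGraph.JoinedOn

variable {V : Type*} {G : SimpleGraph V} {s t : Set V} {u v w : V}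

theorem refl (h : u ∈ s) : G.JoinedOn s u u := ⟨.nil, by simpa⟩

theorem symm (h : G.JoinedOn s u v) : G.JoinedOn s v u := by
  obtain ⟨W, hW⟩ := h
  exact ⟨W.reverse, by simpa using hW⟩

theorem trans (h : G.JoinedOn s u v) (h' : G.JoinedOn s v w) : G.JoinedOn s u w := by
  obtain ⟨W, hW⟩ := h
  obtain ⟨W', hW'⟩ := h'
  refine ⟨W.append W', fun z hz ↦ ?_⟩
  rcases Walk.mem_support_append_iff .. |>.1 hz with h | h
  exacts [hW z h, hW' z h]

theorem mono (h : G.JoinedOn s u v) (hst : s ⊆ t) : G.JoinedOn t u v := by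
  obtain ⟨W, hW⟩ := h
  exact ⟨W, fun z hz ↦ hst (hW z hz)⟩

theorem left_mem (h : G.JoinedOn s u v) : u ∈ s := by
  obtain ⟨W, hW⟩ := h
  exact hW _ W.start_mem_support

theorem right_mem (h : G.JoinedOn s u v) : v ∈ s := h.symm.left_mem

theorem of_adj (h : G.Adj u v) (hu : u ∈ s) (hv : v ∈ s) : G.JoinedOn s u v :=
  ⟨h.toWalk, by simp [hu, hv]⟩

end SimpleGraph.JoinedOn

namespace ToneColoring.PlanarEmbedding

open Set

variable {V : Type*} {G : SimpleGraph V} (E : PlanarEmbedding G)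

/-- The drawing of the subgraph induced on `s`. -/
def drawing (s : Set V) : Set Plane :=
  E.point '' s ∪ ⋃ e ∈ {e ∈ G.edgeSet | ∀ v ∈ e, v ∈ s}, E.arc e

theorem drawing_mono {s t : Set V} (h : s ⊆ t) : E.drawing s ⊆ E.drawing t :=
  union_subset_union (image_mono h)
    (biUnion_subset_biUnion_left fun _ he ↦ ⟨he.1, fun v hv ↦ h (he.2 v hv)⟩)

theorem drawing_subset_support (s : Set V) : E.drawing s ⊆ E.support :=
  union_subset_union (image_subset_range _ _) (biUnion_subset_biUnion_left fun _ he ↦ he.1)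

theorem drawing_univ : E.drawing univ = E.support := by
  simp [drawing, support]

theorem isCompact_arc {e : Sym2 V} (he : e ∈ G.edgeSet) : IsCompact (E.arc e) := by
  induction e with
  | h u v =>
    obtain ⟨γ, -, h⟩ := E.isArc u v he
    rw [← h]
    exact isCompact_range γ.continuous

theorem isCompact_drawing [Finite V] (s : Set V) : IsCompact (E.drawing s) :=
  ((toFinite s).image _).isCompact.union
    ((toFinite _).isCompact_biUnion fun _ he ↦ E.isCompact_arc he.1)

theorem mem_of_point_mem_drawing {s : Set V} {v : V} (h : E.point v ∈ E.drawing s) : v ∈ s := by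
  rcases h with ⟨w, hw, h⟩ | h
  · rwa [← E.point_injective h]
  · obtain ⟨e, he, h⟩ := mem_iUnion₂.1 h
    exact he.2 v (E.mem_of_point_mem_arc e he.1 v h)

theorem point_mem_drawing {s : Set V} {v : V} (h : v ∈ s) : E.point v ∈ E.drawing s :=
  Or.inl (mem_image_of_mem _ h)

/-- A common point is not a vertex, so it lies on an arc of each side. Arcs of distinct edges meet
only in vertices, hence it is the same edge, whose ends would lie in both sets. -/
theorem disjoint_drawing {s t : Set V} (h : Disjoint s t) :
    Disjoint (E.drawing s) (E.drawing t) := by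
  rw [Set.disjoint_left] at h ⊢
  intro z hs ht
  have hz : z ∉ range E.point := by
    rintro ⟨w, rfl⟩
    exact h (E.mem_of_point_mem_drawing hs) (E.mem_of_point_mem_drawing ht)
  obtain ⟨e, he, hze⟩ := mem_iUnion₂.1 (hs.resolve_left fun h ↦ hz (image_subset_range _ _ h))
  obtain ⟨e', he', hze'⟩ := mem_iUnion₂.1 (ht.resolve_left fun h ↦ hz (image_subset_range _ _ h))
  refine hz (E.arc_inter_arc e he.1 e' he'.1 ?_ ⟨hze, hze'⟩)
  rintro rfl
  exact h (he.2 _ e.out_fst_mem) (he'.2 _ e.out_fst_mem)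

theorem joinedIn_drawing {s : Set V} {u v : V} (h : G.JoinedOn s u v) :
    JoinedIn (E.drawing s) (E.point u) (E.point v) := by
  obtain ⟨W, hW⟩ := h
  induction W with
  | nil => exact JoinedIn.refl (E.point_mem_drawing (hW _ (by simp)))
  | @cons u w v huw W ih =>
    refine JoinedIn.trans ?_ (ih fun z hz ↦ hW z (by simp [hz]))
    obtain ⟨γ, -, h⟩ := E.isArc u w huw
    refine ⟨γ, fun t ↦ Or.inr (mem_iUnion₂.2 ⟨s(u, w), ⟨huw, ?_⟩, h ▸ mem_range_self t⟩)⟩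
    intro z hz
    rcases Sym2.mem_iff.1 hz with rfl | rfl
    · exact hW _ (by simp)
    · exact hW _ (by simp)

theorem isOpen_compl_support [Finite V] : IsOpen E.supportᶜ := by
  rw [← drawing_univ]
  exact (E.isCompact_drawing _).isClosed.isOpen_compl

/-- A point of a face can be joined to a vertex on the boundary of the face inside a set which
avoids the drawing of the graph without that vertex. -/
theorem exists_joinedIn_of_mem_frontier [Finite V] {F : Set Plane} (hF : E.IsFace F) {o : Plane}
    (ho : o ∈ F) {v : V} (hv : E.point v ∈ frontier F) :
    ∃ B : Set Plane, JoinedIn B o (E.point v) ∧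
      ∀ s : Set V, v ∉ s → Disjoint B (E.drawing s) := by
  obtain ⟨x, hx, rfl⟩ := hF
  have hopen : IsOpen (connectedComponentIn E.supportᶜ x) :=
    E.isOpen_compl_support.connectedComponentIn
  have hpc := (hopen.isConnected_iff_isPathConnected).1
    (isConnected_connectedComponentIn_iff.2 hx)
  -- The drawing without `v` is compact and misses the point of `v`, so a ball around that point is
  -- free of it. The face enters this ball, and the last stretch runs inside the ball.
  have hv' : E.point v ∉ E.drawing {v}ᶜ := fun h ↦ E.mem_of_point_mem_drawing h rfl
  obtain ⟨ε, hε, hball⟩ := Metric.isOpen_iff.1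
    (E.isCompact_drawing {v}ᶜ).isClosed.isOpen_compl _ hv'
  obtain ⟨q, hq, hqv⟩ := Metric.mem_closure_iff.1 (frontier_subset_closure hv) ε hε
  refine ⟨connectedComponentIn E.supportᶜ x ∪ Metric.ball (E.point v) ε, ?_, fun s hs ↦ ?_⟩
  · refine ((hpc.joinedIn o ho q hq).mono subset_union_left).trans ?_
    refine JoinedIn.mono ?_ subset_union_right
    exact ((convex_ball (E.point v) ε).isPathConnected ⟨_, Metric.mem_ball_self hε⟩).joinedIn
      q (by rwa [Metric.mem_ball, dist_comm]) _ (Metric.mem_ball_self hε)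
  · have hs' : E.drawing s ⊆ E.drawing {v}ᶜ :=
      E.drawing_mono fun z hz h ↦ hs (by rwa [← mem_singleton_iff.1 h])
    rw [Set.disjoint_left]
    rintro z (hz | hz) hzs
    · exact connectedComponentIn_subset _ _ hz (E.drawing_subset_support s hzs)
    · exact hball hz (hs' hzs)

end ToneColoring.PlanarEmbedding

/-! ### Excluded minors of outerplanar graphs -/

namespace ToneColoring.IsOuterplanar

open Set

variable {V : Type*} [Finite V] {G : SimpleGraph V}

/-- All that is needed of the embedding, moved to `ℂ`: `o` is a point of the outer face acting as a
new vertex adjacent to every vertex, with `B v` carrying the new edges. No disjointness between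
different `B v` is needed, as these edges share the end `o`. -/
theorem exists_outer_sets (hG : IsOuterplanar G) :
    ∃ (p : V → ℂ) (o : ℂ) (D : Set V → Set ℂ) (B : V → Set ℂ), Function.Injective p ∧
      (∀ v, o ≠ p v) ∧ (∀ s u v, G.JoinedOn s u v → JoinedIn (D s) (p u) (p v)) ∧
      (∀ v, JoinedIn (B v) o (p v)) ∧ (∀ s t, Disjoint s t → Disjoint (D s) (D t)) ∧
      ∀ v s, v ∉ s → Disjoint (B v) (D s) := by
  obtain ⟨E, F, ⟨hF, -⟩, hv⟩ := hG
  obtain ⟨o, ho, hoF⟩ : ∃ o ∈ E.supportᶜ, o ∈ F := by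
    obtain ⟨o, ho, rfl⟩ := hF
    exact ⟨o, ho, mem_connectedComponentIn ho⟩
  choose B hB hB' using fun v ↦ E.exists_joinedIn_of_mem_frontier hF hoF (hv v)
  let φ := Complex.orthonormalBasisOneI.repr.symm
  have hφ : Continuous φ := φ.continuous
  refine ⟨fun v ↦ φ (E.point v), φ o, fun s ↦ φ '' E.drawing s, fun v ↦ φ '' B v,
    φ.injective.comp E.point_injective, fun v h ↦ ?_, fun s u v h ↦ (E.joinedIn_drawing h).map hφ,
    fun v ↦ (hB v).map hφ, fun s t h ↦ ?_, fun v s h ↦ ?_⟩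
  · exact ho (Or.inl ⟨v, (φ.injective h).symm⟩)
  · exact (disjoint_image_iff φ.injective).2 (E.disjoint_drawing h)
  · exact (disjoint_image_iff φ.injective).2 (hB' v s h)

/-- An outerplanar graph contains no subdivision of `K₂,₃`. -/
theorem not_theta (hG : IsOuterplanar G) {a b : V} (x : Fin 3 → V) (s t : Fin 3 → Set V)
    (hs : ∀ i, G.JoinedOn (s i) a (x i)) (ht : ∀ i, G.JoinedOn (t i) b (x i))
    (hst : ∀ i j, i ≠ j → Disjoint (s i) (t j)) : False := by
  obtain ⟨p, o, D, B, hp, hop, hD, hB, hDD, hBD⟩ := hG.exists_outer_sets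
  have hne : ∀ i j u v, i ≠ j → u ∈ s i → v ∈ t j → u ≠ v := fun i j u v hij hu hv ↦
    (hst i j hij).ne_of_mem hu hv
  have hsd : ∀ k l, k ≠ l → x k ∉ s l := fun k l h hx ↦
    Set.disjoint_left.1 (hst l k h.symm) hx (ht k).right_mem
  have htd : ∀ k l, k ≠ l → x k ∉ t l := fun k l h hx ↦
    Set.disjoint_left.1 (hst k l h) (hs k).right_mem hx
  have hab : a ≠ b := hne 0 1 _ _ (by decide) (hs 0).left_mem (ht 1).left_mem
  have hax : ∀ k, a ≠ x k := fun k h ↦ by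
    have h3 : ∀ k : Fin 3, k + 1 ≠ k := by decide
    exact hne _ _ _ _ (h3 k) (hs (k + 1)).left_mem (ht k).right_mem h
  have hbx : ∀ k, b ≠ x k := fun k h ↦ by
    have h3 : ∀ k : Fin 3, k ≠ k + 1 := by decide
    exact hne _ _ _ _ (h3 k) (hs k).right_mem (ht (k + 1)).left_mem h.symm
  -- The point `o` joins `a` and `b` on one side of a `K₃,₃`; the other side consists of the `x k`.
  refine not_drawing_completeBipartite ![o, p a, p b] (fun k ↦ p (x k)) ?_ ?_ ?_
    ![fun k ↦ B (x k), fun k ↦ D (s k), fun k ↦ D (t k)] ?_ ?_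
  · rw [← List.nodup_ofFn]
    simp [hop, hp.eq_iff, hab]
  · refine hp.comp fun k l h ↦ ?_
    by_contra hkl
    exact hsd k l hkl (h ▸ (hs l).right_mem)
  · intro i k
    fin_cases i
    · exact hop _
    · exact hp.ne (hax k)
    · exact hp.ne (hbx k)
  · intro i k
    fin_cases i
    · exact hB _
    · exact hD _ _ _ (hs k)
    · exact hD _ _ _ (ht k)
  · intro i j k l hij hkl
    fin_cases i <;> fin_cases j
    · exact absurd rfl hij
    · exact hBD _ _ (hsd k l hkl)
    · exact hBD _ _ (htd k l hkl)
    · exact (hBD _ _ (hsd l k hkl.symm)).symm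
    · exact absurd rfl hij
    · exact hDD _ _ (hst k l hkl)
    · exact (hBD _ _ (htd l k hkl.symm)).symm
    · exact (hDD _ _ (hst l k hkl.symm)).symm
    · exact absurd rfl hij

/-- An outerplanar graph has no `K₄` minor in which three of the branch sets are vertices. -/
theorem not_tetrahedron (hG : IsOuterplanar G) {w : V} (t : Fin 3 → V) (T : Fin 3 → Set V)
    (ht : ∀ i j, i ≠ j → G.Adj (t i) (t j)) (hT : ∀ i, G.JoinedOn (T i) w (t i))
    (htT : ∀ i j, i ≠ j → t i ∉ T j) : False := by
  obtain ⟨p, o, D, B, hp, hop, hD, hB, hDD, hBD⟩ := hG.exists_outer_sets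
  have hwt : ∀ i, w ≠ t i := fun i h ↦ by
    have h3 : ∀ i : Fin 3, i ≠ i + 1 := by decide
    exact htT _ _ (h3 i) (h ▸ (hT (i + 1)).left_mem)
  have hne : ∀ i j, i ≠ j → t i ≠ t j := fun i j h ↦ (ht i j h).ne
  have h01 := ht 0 1 (by decide)
  have h02 := ht 0 2 (by decide)
  have h12 := ht 1 2 (by decide)
  have hedge : ∀ i j, i ≠ j → JoinedIn (D {t i, t j}) (p (t i)) (p (t j)) := fun i j h ↦
    hD _ _ _ (.of_adj (ht i j h) (by simp) (by simp))
  have hBw : ∀ i j, i ≠ j → Disjoint (B w) (D {t i, t j}) := fun i j _ ↦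
    hBD _ _ (by simp [hwt])
  have hBT : ∀ i j, i ≠ j → Disjoint (B (t i)) (D (T j)) := fun i j h ↦ hBD _ _ (htT i j h)
  have hBt : ∀ i j k, i ≠ j → i ≠ k → Disjoint (B (t i)) (D {t j, t k}) := fun i j k h h' ↦
    hBD _ _ (by simp [hne i j h, hne i k h'])
  have hTt : ∀ i j k, i ≠ j → i ≠ k → Disjoint (D (T i)) (D {t j, t k}) := fun i j k h h' ↦
    hDD _ _ (by simp [htT j i h.symm, htT k i h'.symm])
  -- In this `K₅` the edges from `w` to the `t i` are drawn in the `D (T i)`. They share the end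
  -- `w`, so the sets `T i` may overlap; they only have to avoid the other two `t j`.
  refine not_drawing_completeGraph_five ![o, p w, p (t 0), p (t 1), p (t 2)] ?_
    ![![∅, B w, B (t 0), B (t 1), B (t 2)], ![∅, ∅, D (T 0), D (T 1), D (T 2)],
      ![∅, ∅, ∅, D {t 0, t 1}, D {t 0, t 2}], ![∅, ∅, ∅, ∅, D {t 1, t 2}],
      ![∅, ∅, ∅, ∅, ∅]] ?_ ?_
  · rw [← List.nodup_ofFn]
    simp [hop, hp.eq_iff, hwt, h01.ne, h02.ne, h12.ne]
  · intro i j hij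
    fin_cases i <;> fin_cases j <;>
      first
        | exact absurd hij (by decide)
        | exact hB _
        | exact hD _ _ _ (hT _)
        | exact hedge 0 1 (by decide)
        | exact hedge 0 2 (by decide)
        | exact hedge 1 2 (by decide)
  · simp only [List.forall_mem_cons, List.not_mem_nil, false_imp_iff, implies_true, and_true]
    exact ⟨hBw 0 1 (by decide), hBw 0 2 (by decide), hBw 1 2 (by decide),
      hBT 0 1 (by decide), hBT 0 2 (by decide), hBt 0 1 2 (by decide) (by decide),
      hBT 1 0 (by decide), hBT 1 2 (by decide), hBt 1 0 2 (by decide) (by decide),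
      hBT 2 0 (by decide), hBT 2 1 (by decide), hBt 2 0 1 (by decide) (by decide),
      hTt 0 1 2 (by decide) (by decide), hTt 1 0 2 (by decide) (by decide),
      hTt 2 0 1 (by decide) (by decide)⟩

end ToneColoring.IsOuterplanar

/-! ### Induced cycles, closed sets and partial colorings -/

namespace ToneColoring

open Set SimpleGraph

variable {V : Type*} {G : SimpleGraph V}

theorem IsSubcubic.eq_of_adj [Fintype V] (h : IsSubcubic G) {v a b c d : V} (ha : G.Adj v a)
    (hb : G.Adj v b) (hc : G.Adj v c) (hd : G.Adj v d) (hab : a ≠ b) (hac : a ≠ c) (hbc : b ≠ c) :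
    d = a ∨ d = b ∨ d = c := by
  classical
  by_contra! hne
  have h4 : ({a, b, c, d} : Finset V).card = 4 :=
    Finset.card_eq_of_equiv_fin (by
      exact (Finset.equivFinOfCardEq (by
        rw [Finset.card_insert_of_notMem, Finset.card_insert_of_notMem,
          Finset.card_insert_of_notMem, Finset.card_singleton] <;>
        simp [*, hne.1.symm, hne.2.1.symm, hne.2.2.symm])))
  have hsub : ({a, b, c, d} : Finset V) ⊆ G.neighborFinset v := by
    intro z hz
    simp only [Finset.mem_insert, Finset.mem_singleton] at hz
    rw [mem_neighborFinset]
    rcases hz with rfl | rfl | rfl | rfl <;> assumption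
  have h1 := Finset.card_le_card hsub
  rw [h4, card_neighborFinset_eq_degree] at h1
  have h2 := G.degree_le_maxDegree v
  unfold IsSubcubic at h
  have h3 : G.maxDegree ≤ 3 := by convert h
  omega

theorem joinedOn_chain (p : ℕ → V) {i j : ℕ} (hij : i ≤ j)
    (hp : ∀ k, i ≤ k → k < j → G.Adj (p k) (p (k + 1))) :
    G.JoinedOn (p '' Icc i j) (p i) (p j) := by
  induction j, hij using Nat.le_induction with
  | base => exact .refl ⟨i, by simp⟩
  | succ j hij ih =>
    refine ((ih fun k hk hkj ↦ hp k hk (by omega)).mono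
      (image_mono (Icc_subset_Icc_right (Nat.le_succ j)))).trans ?_
    exact .of_adj (hp j hij (Nat.lt_succ_self j)) ⟨j, ⟨hij, Nat.le_succ j⟩, rfl⟩
      ⟨j + 1, ⟨by omega, le_rfl⟩, rfl⟩

/-- A shortest path inside `s` among those whose ends satisfy `Q`. -/
theorem exists_geodesic {s : Set V} {Q : V → V → Prop} {u v : V} (hQ : Q u v)
    (h : G.JoinedOn s u v) :
    ∃ (m : ℕ) (p : ℕ → V), Q (p 0) (p m) ∧ (∀ i ≤ m, p i ∈ s) ∧
      (∀ i < m, G.Adj (p i) (p (i + 1))) ∧ (∀ i ≤ m, ∀ j ≤ m, p i = p j → i = j) ∧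
      (∀ i ≤ m, ∀ j ≤ m, G.Adj (p i) (p j) → j = i + 1 ∨ i = j + 1) ∧
      ∀ i j, i ≤ j → j ≤ m → Q (p i) (p j) → i = 0 ∧ j = m := by
  classical
  have hex : ∃ m, ∃ u v, ∃ W : G.Walk u v, Q u v ∧ (∀ z ∈ W.support, z ∈ s) ∧ W.length = m := by
    obtain ⟨W, hW⟩ := h
    exact ⟨_, u, v, W, hQ, hW, rfl⟩
  obtain ⟨u, v, W, hQ, hW, hlen⟩ := Nat.find_spec hex
  set m := Nat.find hex with hm
  have hmin : ∀ (u v : V) (W : G.Walk u v), Q u v → (∀ z ∈ W.support, z ∈ s) → m ≤ W.length :=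
    fun u v W hQ hW ↦ Nat.find_min' hex ⟨u, v, W, hQ, hW, rfl⟩
  have hmem : ∀ i, W.getVert i ∈ s := fun i ↦ hW _ (W.getVert_mem_support i)
  -- Splicing `W'` in between the positions `i` and `j` gives a competitor with the same ends.
  -- Applied to a single edge and to the empty walk, this excludes chords and repeated vertices.
  have hsub : ∀ i j, i ≤ j → j ≤ m → ∀ W' : G.Walk (W.getVert i) (W.getVert j),
      (∀ z ∈ W'.support, z ∈ s) → j - i ≤ W'.length := by
    intro i j hij hj W' hW'
    have := hmin u v (((W.take i).append W').append (W.drop j)) hQ (by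
      intro z hz
      rw [Walk.mem_support_append_iff, Walk.mem_support_append_iff] at hz
      rcases hz with (hz | hz) | hz
      · exact hW z ((W.isSubwalk_take i).support_subset hz)
      · exact hW' z hz
      · exact hW z ((W.isSubwalk_drop j).support_subset hz))
    rw [Walk.length_append, Walk.length_append, Walk.take_length, Walk.drop_length] at this
    omega
  have hadj : ∀ i j, i ≤ j → j ≤ m → G.Adj (W.getVert i) (W.getVert j) → j = i + 1 := by
    intro i j hij hj h
    have h1 := hsub i j hij hj h.toWalk (by simp [hmem])
    have h2 : i ≠ j := by
      rintro rfl
      exact h.ne rfl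
    simp at h1
    omega
  have hinj : ∀ i j, i ≤ j → j ≤ m → W.getVert i = W.getVert j → i = j := by
    intro i j hij hj h
    have h1 := hsub i j hij hj (Walk.nil.copy rfl h) (by simp [hmem])
    simp at h1
    omega
  refine ⟨m, W.getVert, ?_, fun i _ ↦ hmem i, fun i hi ↦ W.adj_getVert_succ (by omega), ?_, ?_, ?_⟩
  · rw [← hlen]
    simpa using hQ
  · intro i hi j hj h
    rcases le_total i j with hij | hij
    · exact hinj i j hij hj h
    · exact (hinj j i hij hi h.symm).symm
  · intro i hi j hj h
    rcases le_total i j with hij | hij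
    · exact Or.inl (hadj i j hij hj h)
    · exact Or.inr (hadj j i hij hi h.symm)
  · intro i j hij hj h
    -- The section from `i` to `j` is itself a competitor when its ends satisfy `Q`, so it must be
    -- the whole path.
    have hlen' : ∃ W' : G.Walk (W.getVert i) (W.getVert j), (∀ z ∈ W'.support, z ∈ s) ∧
        W'.length = j - i := by
      have key : ∀ k, i + k ≤ m → ∃ W' : G.Walk (W.getVert i) (W.getVert (i + k)),
          (∀ z ∈ W'.support, z ∈ s) ∧ W'.length = k := by
        intro k
        induction k with
        | zero => exact fun _ ↦ ⟨.nil, by simp [hmem], rfl⟩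
        | succ k ih =>
          intro hk
          obtain ⟨W', h1, h2⟩ := ih (by omega)
          refine ⟨W'.concat (W.adj_getVert_succ (by omega)), ?_, by simp [h2]⟩
          intro z hz
          rw [Walk.support_concat, List.mem_append, List.mem_singleton] at hz
          rcases hz with hz | rfl
          exacts [h1 z hz, hmem _]
      obtain ⟨k, rfl⟩ := Nat.exists_eq_add_of_le hij
      obtain ⟨W', h1, h2⟩ := key k hj
      exact ⟨W', h1, by omega⟩
    obtain ⟨W', h1, h2⟩ := hlen'
    have := hmin _ _ W' h h1
    omega

/-- `p 0, …, p (n - 1)` is an induced cycle of length `n`. -/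
structure IsInducedCycle (G : SimpleGraph V) (n : ℕ) (p : ℕ → V) : Prop where
  three_le : 3 ≤ n
  inj : ∀ i < n, ∀ j < n, p i = p j → i = j
  adj_iff : ∀ i < n, ∀ j < n,
    (G.Adj (p i) (p j) ↔ j = i + 1 ∨ i = j + 1 ∨ (i = 0 ∧ j = n - 1) ∨ (j = 0 ∧ i = n - 1))

/-- `f` is a 3-good coloring of the subgraph induced on `S`. -/
def GoodOn (G : SimpleGraph V) (f : V → Finset (Fin 11)) (S : Set V) : Prop :=
  (∀ v ∈ S, (f v).card = 3) ∧ (∀ u ∈ S, ∀ v ∈ S, G.Adj u v → Disjoint (f u) (f v)) ∧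
    ∀ u ∈ S, ∀ v ∈ S, ∀ w ∈ S, u ≠ v → ¬ G.Adj u v → G.Adj w u → G.Adj w v →
      (f u ∩ f v).card = 1

/-- Two edges that join `S` to the same component of the complement of `S` have adjacent ends
in `S`. -/
def IsClosedUnder (G : SimpleGraph V) (S : Set V) : Prop :=
  ∀ a ∈ S, ∀ b ∈ S, ∀ u ∉ S, ∀ v ∉ S, G.Adj a u → G.Adj b v → G.JoinedOn Sᶜ u v →
    (a = b ∧ u = v) ∨ G.Adj a b

theorem IsInducedCycle.goodOn {n : ℕ} {p : ℕ → V} (h : IsInducedCycle G n p)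
    {c : ℕ → Finset (Fin 11)} (hc : IsCycleColoring n c) {f : V → Finset (Fin 11)}
    (hf : ∀ i < n, f (p i) = c i) : GoodOn G f (p '' Iio n) := by
  obtain ⟨c1, c2, c3, c4⟩ := hc
  have h3 := h.three_le
  refine ⟨?_, ?_, ?_⟩
  · rintro _ ⟨i, hi, rfl⟩
    rw [hf i hi]
    exact c1 i hi
  · rintro _ ⟨i, hi, rfl⟩ _ ⟨j, hj, rfl⟩ hij
    rw [hf i hi, hf j hj]
    simp only [mem_Iio] at hi hj
    rcases (h.adj_iff i hi j hj).1 hij with rfl | rfl | ⟨rfl, rfl⟩ | ⟨rfl, rfl⟩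
    · exact c2 i hj
    · exact (c2 j hi).symm
    · exact c3
    · exact c3.symm
  · rintro _ ⟨i, hi, rfl⟩ _ ⟨j, hj, rfl⟩ _ ⟨k, hk, rfl⟩ hne hij hki hkj
    rw [hf i hi, hf j hj]
    simp only [mem_Iio] at hi hj hk
    rw [h.adj_iff i hi j hj] at hij
    rw [h.adj_iff k hk i hi] at hki
    rw [h.adj_iff k hk j hj] at hkj
    have hne' : i ≠ j := fun h ↦ hne (by rw [h])
    -- Distinct nonadjacent vertices force length at least four.
    obtain ⟨d1, d2, d3⟩ := c4 (by omega)
    have : j = i + 2 ∨ i = j + 2 ∨ (i = 0 ∧ j = n - 2) ∨ (j = 0 ∧ i = n - 2) ∨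
        (i = 1 ∧ j = n - 1) ∨ (j = 1 ∧ i = n - 1) := by omega
    rcases this with rfl | rfl | ⟨rfl, rfl⟩ | ⟨rfl, rfl⟩ | ⟨rfl, rfl⟩ | ⟨rfl, rfl⟩
    · exact d1 i hj
    · rw [Finset.inter_comm]; exact d1 j hi
    · exact d2
    · rw [Finset.inter_comm]; exact d2
    · exact d3
    · rw [Finset.inter_comm]; exact d3

theorem IsInducedCycle.disjoint_image {n : ℕ} {p : ℕ → V} (h : IsInducedCycle G n p)
    {I J : Set ℕ} (hI : ∀ i ∈ I, i < n) (hJ : ∀ i ∈ J, i < n) (hIJ : ∀ i ∈ I, i ∉ J) :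
    Disjoint (p '' I) (p '' J) := by
  rw [Set.disjoint_left]
  rintro _ ⟨i, hi, rfl⟩ ⟨j, hj, hij⟩
  rw [h.inj j (hJ j hj) i (hI i hi) hij] at hj
  exact hIJ i hi hj

/-- Otherwise `p i` and `p j` are linked by three independent routes, namely the two arcs of the
cycle, each with an inner vertex, and a walk outside `S`. This is the configuration excluded by
`not_theta`. -/
theorem IsInducedCycle.adj_of_joinedOn_of_lt [Finite V] (hG : IsOuterplanar G) {n : ℕ} {p : ℕ → V}
    (h : IsInducedCycle G n p) {S : Set V} (hS : p '' Iio n ⊆ S) {i j : ℕ} (hij : i < j)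
    (hj : j < n) {u v : V} (hv : v ∉ S) (hiu : G.Adj (p i) u)
    (hjv : G.Adj (p j) v) (huv : G.JoinedOn Sᶜ u v) : G.Adj (p i) (p j) := by
  by_contra hna
  rw [h.adj_iff i (hij.trans hj) j hj] at hna
  have h3 := h.three_le
  have hi : i < n := hij.trans hj
  have hpS : ∀ k < n, p k ∈ S := fun k hk ↦ hS ⟨k, hk, rfl⟩
  have hadj : ∀ k, k + 1 < n → G.Adj (p k) (p (k + 1)) := fun k hk ↦
    (h.adj_iff k (by omega) (k + 1) hk).2 (Or.inl rfl)
  have hlast : G.Adj (p 0) (p (n - 1)) :=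
    (h.adj_iff 0 (by omega) (n - 1) (by omega)).2 (by omega)
  have hu : u ∉ S := huv.left_mem
  let s₀ : Set V := p '' {k | i ≤ k ∧ k < j}
  let t₀ : Set V := p '' {k | i < k ∧ k ≤ j}
  let s₁ : Set V := p '' {k | k < n ∧ (k ≤ i ∨ j < k)}
  let t₁ : Set V := p '' {k | k < n ∧ (k < i ∨ j ≤ k)}
  -- `x` is an inner vertex of the arc through the closing edge: `p (n - 1)` if `i = 0`, where
  -- nonadjacency gives `j < n - 1`, and `p 0` otherwise.
  obtain ⟨x, hsx, htx⟩ : ∃ x, G.JoinedOn s₁ (p i) x ∧ G.JoinedOn t₁ (p j) x := by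
    rcases Nat.eq_zero_or_pos i with rfl | hi0
    · refine ⟨p (n - 1), .of_adj hlast ⟨0, ⟨by omega, by omega⟩, rfl⟩
        ⟨n - 1, ⟨by omega, by omega⟩, rfl⟩, ?_⟩
      refine (joinedOn_chain p (by omega) fun k _ hk ↦ hadj k (by omega)).mono (image_mono ?_)
      rintro k ⟨h1, h2⟩
      exact ⟨by omega, by omega⟩
    · refine ⟨p 0, ((joinedOn_chain p (Nat.zero_le i) fun k _ hk ↦ hadj k (by omega)).mono
        (image_mono ?_)).symm, ?_⟩
      · rintro k ⟨h1, h2⟩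
        exact ⟨by omega, by omega⟩
      · refine ((joinedOn_chain p (i := j) (j := n - 1) (by omega)
          fun k _ hk ↦ hadj k (by omega)).mono (image_mono ?_)).trans
          (.of_adj hlast.symm ⟨n - 1, ⟨by omega, by omega⟩, rfl⟩ ⟨0, ⟨by omega, by omega⟩, rfl⟩)
        rintro k ⟨h1, h2⟩
        exact ⟨by omega, by omega⟩
  have hd2 : ∀ (I : Set ℕ) (k : ℕ), (∀ l ∈ I, l < n) → k < n → k ∉ I →
      Disjoint (p '' I) (insert (p k) Sᶜ) := by
    intro I k hI hk hkI
    rw [Set.disjoint_left]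
    rintro _ ⟨l, hl, rfl⟩ (h' | h')
    · rw [h.inj l (hI l hl) k hk h'] at hl
      exact hkI hl
    · exact h' (hpS l (hI l hl))
  refine hG.not_theta (a := p i) (b := p j) ![p (i + 1), x, u] ![s₀, s₁, insert (p i) Sᶜ]
    ![t₀, t₁, insert (p j) Sᶜ] ?_ ?_ ?_
  · intro k
    fin_cases k
    · exact .of_adj (hadj i (by omega)) ⟨i, ⟨le_rfl, hij⟩, rfl⟩
        ⟨i + 1, ⟨by omega, by omega⟩, rfl⟩
    · exact hsx
    · exact .of_adj hiu (Or.inl rfl) (Or.inr hu)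
  · intro k
    fin_cases k
    · refine ((joinedOn_chain p (i := i + 1) (by omega)
        fun k _ hk ↦ hadj k (by omega)).mono (image_mono ?_)).symm
      rintro k ⟨h1, h2⟩
      exact ⟨by omega, by omega⟩
    · exact htx
    · exact (JoinedOn.of_adj hjv (Or.inl rfl) (Or.inr hv)).trans
        (huv.symm.mono (subset_insert _ _))
  · intro k l hkl
    fin_cases k <;> fin_cases l
    · exact absurd rfl hkl
    · exact h.disjoint_image (fun k hk ↦ by have := hk.2; omega) (fun k hk ↦ hk.1)
        (fun k hk hk' ↦ by have := hk.1; have := hk.2; have := hk'.2; omega)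
    · exact hd2 _ j (fun k hk ↦ by have := hk.2; omega) hj (fun hk ↦ by have := hk.2; omega)
    · exact h.disjoint_image (fun k hk ↦ hk.1) (fun k hk ↦ by have := hk.2; omega)
        (fun k hk hk' ↦ by have := hk.2; have := hk'.1; have := hk'.2; omega)
    · exact absurd rfl hkl
    · exact hd2 _ j (fun k hk ↦ hk.1) hj (fun hk ↦ by have := hk.2; omega)
    · exact (hd2 _ i (fun k hk ↦ by have := hk.2; omega) hi
        (fun hk ↦ by have := hk.1; omega)).symm
    · exact (hd2 _ i (fun k hk ↦ hk.1) hi (fun hk ↦ by have := hk.2; omega)).symm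
    · exact absurd rfl hkl

theorem IsInducedCycle.exists_two_adj {n : ℕ} {p : ℕ → V} (h : IsInducedCycle G n p) {i : ℕ}
    (hi : i < n) : ∃ j < n, ∃ k < n, p j ≠ p k ∧ G.Adj (p i) (p j) ∧ G.Adj (p i) (p k) := by
  have h3 := h.three_le
  have key : ∃ j < n, ∃ k < n, j ≠ k ∧
      (j = i + 1 ∨ i = j + 1 ∨ (i = 0 ∧ j = n - 1) ∨ (j = 0 ∧ i = n - 1)) ∧
      (k = i + 1 ∨ i = k + 1 ∨ (i = 0 ∧ k = n - 1) ∨ (k = 0 ∧ i = n - 1)) := by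
    rcases Nat.eq_zero_or_pos i with rfl | h0
    · exact ⟨1, by omega, n - 1, by omega, by omega, by omega, by omega⟩
    · rcases Nat.lt_or_ge (i + 1) n with h1 | h1
      · exact ⟨i - 1, by omega, i + 1, by omega, by omega, by omega, by omega⟩
      · exact ⟨i - 1, by omega, 0, by omega, by omega, by omega, by omega⟩
  obtain ⟨j, hj, k, hk, hne, h1, h2⟩ := key
  exact ⟨j, hj, k, hk, fun h' ↦ hne (h.inj j hj k hk h'), (h.adj_iff i hi j hj).2 h1,
    (h.adj_iff i hi k hk).2 h2⟩

/-- Distinct ends fall under the previous theta argument. At a single cycle vertex, two of the at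
most three neighbors are on the cycle, so only one edge can leave. -/
theorem IsInducedCycle.attach [Fintype V] (hG : IsOuterplanar G) (hsub : IsSubcubic G) {n : ℕ}
    {p : ℕ → V} (h : IsInducedCycle G n p) {S : Set V} (hS : p '' Iio n ⊆ S) {a b u v : V}
    (ha : a ∈ p '' Iio n) (hb : b ∈ p '' Iio n) (hu : u ∉ S) (hv : v ∉ S) (hau : G.Adj a u)
    (hbv : G.Adj b v) (huv : G.JoinedOn Sᶜ u v) : (a = b ∧ u = v) ∨ G.Adj a b := by
  obtain ⟨i, hi, rfl⟩ := ha
  obtain ⟨j, hj, rfl⟩ := hb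
  simp only [mem_Iio] at hi hj
  rcases lt_trichotomy i j with hij | rfl | hij
  · exact Or.inr (h.adj_of_joinedOn_of_lt hG hS hij hj hv hau hbv huv)
  · refine Or.inl ⟨rfl, ?_⟩
    obtain ⟨k, hk, l, hl, hkl, h1, h2⟩ := h.exists_two_adj hi
    have hne : ∀ z ∉ S, ∀ k < n, p k ≠ z := fun z hz k hk h' ↦ hz (h' ▸ hS ⟨k, hk, rfl⟩)
    rcases hsub.eq_of_adj h1 h2 hau hbv hkl (hne u hu k hk) (hne u hu l hl) with h' | h' | h'
    · exact absurd h'.symm (hne v hv k hk)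
    · exact absurd h'.symm (hne v hv l hl)
    · exact h'.symm
  · exact Or.inr (h.adj_of_joinedOn_of_lt hG hS hij hi hu hbv hau huv.symm).symm

/-- The condition `hD` prevents a component from seeing the old set off the cycle and the new part
of the cycle at once. Hence both edges leave from `S`, where the old invariant applies, or both from
the cycle, where `attach` applies. -/
theorem IsClosedUnder.union_cycle [Fintype V] (hG : IsOuterplanar G) (hsub : IsSubcubic G)
    {S : Set V} (hS : IsClosedUnder G S) {n : ℕ} {p : ℕ → V} (h : IsInducedCycle G n p)
    (hD : ∀ d ∈ p '' Iio n, d ∉ S → ∀ b ∈ S, ∀ w ∉ S ∪ p '' Iio n, G.JoinedOn Sᶜ d w →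
      G.Adj b w → b ∈ p '' Iio n) : IsClosedUnder G (S ∪ p '' Iio n) := by
  intro a ha b hb u hu v hv hau hbv huv
  have huv' : G.JoinedOn Sᶜ u v := huv.mono (compl_subset_compl.2 subset_union_left)
  have huS : u ∉ S := fun h ↦ hu (Or.inl h)
  have hvS : v ∉ S := fun h ↦ hv (Or.inl h)
  have hab : (a ∈ S ∧ b ∈ S) ∨ (a ∈ p '' Iio n ∧ b ∈ p '' Iio n) := by
    by_cases haS : a ∈ S
    · by_cases hbS : b ∈ S
      · exact Or.inl ⟨haS, hbS⟩
      · have hbD := hb.resolve_left hbS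
        exact Or.inr ⟨hD b hbD hbS a haS u hu ((JoinedOn.of_adj hbv hbS hvS).trans huv'.symm) hau,
          hbD⟩
    · have haD := ha.resolve_left haS
      refine Or.inr ⟨haD, ?_⟩
      by_cases hbS : b ∈ S
      · exact hD a haD haS b hbS v hv ((JoinedOn.of_adj hau haS huS).trans huv') hbv
      · exact hb.resolve_left hbS
  rcases hab with ⟨haS, hbS⟩ | ⟨haD, hbD⟩
  · exact hS a haS b hbS u huS v hvS hau hbv huv'
  · exact h.attach hG hsub subset_union_right haD hbD hu hv hau hbv huv

/-- Only pairs with one vertex private to each side need new conditions. For a pair on one side,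
`h3` and `h4` rule out a common neighbor private to the other side, unless both vertices also lie on
that other side. -/
theorem GoodOn.union {f : V → Finset (Fin 11)} {S D : Set V} (hS : GoodOn G f S)
    (hD : GoodOn G f D)
    (h1 : ∀ u ∈ D, u ∉ S → ∀ v ∈ S, v ∉ D → G.Adj u v → Disjoint (f u) (f v))
    (h2 : ∀ u ∈ D, u ∉ S → ∀ v ∈ S, v ∉ D → ∀ w ∈ S ∪ D, ¬ G.Adj u v → G.Adj w u → G.Adj w v →
      (f u ∩ f v).card = 1)
    (h3 : ∀ u ∈ D, u ∉ S → ∀ v ∈ D, ∀ w ∈ S, w ∉ D → G.Adj w u → G.Adj w v → u = v)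
    (h4 : ∀ u ∈ S, u ∉ D → ∀ v ∈ S, ∀ w ∈ D, w ∉ S → G.Adj w u → G.Adj w v → u = v) :
    GoodOn G f (S ∪ D) := by
  obtain ⟨s1, s2, s3⟩ := hS
  obtain ⟨d1, d2, d3⟩ := hD
  have hpair : ∀ u ∈ S ∪ D, ∀ v ∈ S ∪ D, (u ∈ S ∧ v ∈ S) ∨ (u ∈ D ∧ v ∈ D) ∨
      ((u ∈ D ∧ u ∉ S) ∧ v ∈ S ∧ v ∉ D) ∨ ((v ∈ D ∧ v ∉ S) ∧ u ∈ S ∧ u ∉ D) := by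
    rintro u hu v hv
    simp only [mem_union] at hu hv
    tauto
  refine ⟨fun v hv ↦ hv.elim (s1 v) (d1 v), ?_, ?_⟩
  · intro u hu v hv huv
    rcases hpair u hu v hv with ⟨a, b⟩ | ⟨a, b⟩ | ⟨⟨a, b⟩, c, d⟩ | ⟨⟨a, b⟩, c, d⟩
    · exact s2 u a v b huv
    · exact d2 u a v b huv
    · exact h1 u a b v c d huv
    · exact (h1 v a b u c d huv.symm).symm
  · intro u hu v hv w hw hne huv hwu hwv
    rcases hpair u hu v hv with ⟨a, b⟩ | ⟨a, b⟩ | ⟨⟨a, b⟩, c, d⟩ | ⟨⟨a, b⟩, c, d⟩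
    · by_cases hwS : w ∈ S
      · exact s3 u a v b w hwS hne huv hwu hwv
      · have hwD := hw.resolve_left hwS
        by_cases huD : u ∈ D
        · by_cases hvD : v ∈ D
          · exact d3 u huD v hvD w hwD hne huv hwu hwv
          · exact absurd (h4 v b hvD u a w hwD hwS hwv hwu).symm hne
        · exact absurd (h4 u a huD v b w hwD hwS hwu hwv) hne
    · by_cases hwD : w ∈ D
      · exact d3 u a v b w hwD hne huv hwu hwv
      · have hwS := hw.resolve_right hwD
        by_cases huS : u ∈ S
        · by_cases hvS : v ∈ S
          · exact s3 u huS v hvS w hwS hne huv hwu hwv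
          · exact absurd (h3 v b hvS u a w hwS hwD hwv hwu).symm hne
        · exact absurd (h3 u a huS v b w hwS hwD hwu hwv) hne
    · exact h2 u a b v c d w hw huv hwu hwv
    · rw [Finset.inter_comm]
      exact h2 v a b u c d w hw (fun h ↦ huv h.symm) hwv hwu

theorem GoodOn.congr {f g : V → Finset (Fin 11)} {S : Set V} (hf : GoodOn G f S)
    (h : ∀ v ∈ S, g v = f v) : GoodOn G g S := by
  obtain ⟨s1, s2, s3⟩ := hf
  refine ⟨fun v hv ↦ by rw [h v hv, s1 v hv], fun u hu v hv huv ↦ ?_,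
    fun u hu v hv w hw hne huv hwu hwv ↦ ?_⟩
  · rw [h u hu, h v hv]
    exact s2 u hu v hv huv
  · rw [h u hu, h v hv]
    exact s3 u hu v hv w hw hne huv hwu hwv

theorem IsInducedCycle.exists_extension {n : ℕ} {p : ℕ → V} (h : IsInducedCycle G n p)
    (S : Set V) (f : V → Finset (Fin 11)) (c : ℕ → Finset (Fin 11))
    (hc : ∀ i < n, p i ∈ S → f (p i) = c i) :
    ∃ g : V → Finset (Fin 11), (∀ v ∈ S, g v = f v) ∧ ∀ i < n, g (p i) = c i := by
  classical
  refine ⟨fun v ↦ if v ∈ S then f v else if h : ∃ i < n, p i = v then c h.choose else ∅,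
    fun v hv ↦ if_pos hv, fun i hi ↦ ?_⟩
  by_cases hS : p i ∈ S
  · simp only [if_pos hS]
    exact hc i hi hS
  · have hex : ∃ j < n, p j = p i := ⟨i, hi, rfl⟩
    simp only [if_neg hS, dif_pos hex]
    rw [h.inj _ hex.choose_spec.1 i hi hex.choose_spec.2]

end ToneColoring

/-! ### Extending a coloring across an edge or at a vertex -/

namespace ToneColoring

open Set SimpleGraph

variable {V : Type*} {G : SimpleGraph V}

/-- A label for an imaginary third neighbor of a chord end that has none in `S`. It merges the
missing-neighbor cases into `exists_chord_coloring_of_ne`. -/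
theorem exists_phantom_label (X Y : Finset (Fin 11)) (hX : X.card = 3) (hY : Y.card = 3)
    (hXY : Disjoint X Y) :
    ∃ A : Finset (Fin 11), A.card = 3 ∧ Disjoint X A ∧ (A ∩ Y).card = 1 := by
  obtain ⟨σ, hσ⟩ := exists_perm_map_eq ![X, Y] ![{0, 1, 2}, {3, 4, 5}]
    (by
      intro i j hij
      fin_cases i <;> fin_cases j <;>
        first | exact absurd rfl hij | assumption | (apply Disjoint.symm; assumption))
    (by decide) (by intro i; fin_cases i <;> simp [hX, hY])
  have h0 := hσ 0
  have h1 := hσ 1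
  simp only [Matrix.cons_val] at h0 h1
  refine ⟨Finset.map σ.toEmbedding {3, 6, 7}, ?_⟩
  rw [← h0, ← h1]
  simp only [← Finset.map_inter, Finset.card_map, Finset.disjoint_map]
  decide

theorem exists_disjoint_label (Z : Finset (Fin 11)) (hZ : Z.card = 3) :
    ∃ A : Finset (Fin 11), A.card = 3 ∧ Disjoint Z A := by
  obtain ⟨A, hA, hc⟩ := Finset.exists_subset_card_eq (s := Zᶜ) (n := 3)
    (by rw [Finset.card_compl, hZ, Fintype.card_fin]; norm_num)
  exact ⟨A, hc, Finset.disjoint_left.2 fun x hx hxA ↦ Finset.mem_compl.1 (hA hxA) hx⟩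

/-- The label seen from `x` on the third side when extending a coloring across the edge `x y`. -/
theorem GoodOn.exists_third_label [Fintype V] (hsub : IsSubcubic G) {f : V → Finset (Fin 11)}
    {S : Set V} (hf : GoodOn G f S) {x y u : V} (hx : x ∈ S) (hy : y ∈ S) (hu : u ∉ S)
    (hxy : G.Adj x y) (hxu : G.Adj x u) :
    ∃ A : Finset (Fin 11), A.card = 3 ∧ Disjoint (f x) A ∧
      (∀ a ∈ S, G.Adj x a → a ≠ y → f a = A) ∧
      ((∃ a ∈ S, G.Adj x a ∧ G.Adj y a ∧ f a = A) ∨ (A ∩ f y).card = 1) := by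
  have hne : ∀ a ∈ S, a ≠ u := fun a ha h ↦ hu (h ▸ ha)
  by_cases h : ∃ a ∈ S, G.Adj x a ∧ a ≠ y
  · obtain ⟨a, ha, hxa, hay⟩ := h
    refine ⟨f a, hf.1 a ha, hf.2.1 x hx a ha hxa, fun a' ha' hxa' hay' ↦ ?_, ?_⟩
    · rcases hsub.eq_of_adj hxa hxy hxu hxa' hay (hne a ha) (hne y hy) with rfl | rfl | rfl
      · rfl
      · exact absurd rfl hay'
      · exact absurd ha' hu
    · by_cases hya : G.Adj y a
      · exact Or.inl ⟨a, ha, hxa, hya, rfl⟩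
      · exact Or.inr (hf.2.2 a ha y hy x hx hay (fun h ↦ hya h.symm) hxa hxy)
  · push Not at h
    obtain ⟨A, h1, h2, h3⟩ := exists_phantom_label (f x) (f y) (hf.1 x hx) (hf.1 y hy)
      (hf.2.1 x hx y hy hxy)
    exact ⟨A, h1, h2, fun a ha hxa hay ↦ absurd (h a ha hxa) hay, Or.inr h3⟩

theorem GoodOn.exists_chord_coloring [Fintype V] (hsub : IsSubcubic G) {f : V → Finset (Fin 11)}
    {S : Set V} (hf : GoodOn G f S) {x y u v : V} (hx : x ∈ S) (hy : y ∈ S) (hu : u ∉ S)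
    (hv : v ∉ S) (hxy : G.Adj x y) (hxu : G.Adj x u) (hyv : G.Adj y v) (m : ℕ) (hm : 1 ≤ m) :
    ∃ c, IsCycleColoring (m + 2) c ∧ c 0 = f x ∧ c (m + 1) = f y ∧
      (∀ a ∈ S, G.Adj x a → a ≠ y → (c 1 ∩ f a).card = 1) ∧
      ∀ b ∈ S, G.Adj y b → b ≠ x → (c m ∩ f b).card = 1 := by
  obtain ⟨A, hA, hxA, hA', hAy⟩ := hf.exists_third_label hsub hx hy hu hxy hxu
  obtain ⟨B, hB, hyB, hB', hBx⟩ := hf.exists_third_label hsub hy hx hv hxy.symm hyv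
  have hX := hf.1 x hx
  have hY := hf.1 y hy
  have hXY := hf.2.1 x hx y hy hxy
  have key : ∃ c, IsCycleColoring (m + 2) c ∧ c 0 = f x ∧ c (m + 1) = f y ∧
      (c 1 ∩ A).card = 1 ∧ (c m ∩ B).card = 1 := by
    have hdis : ∀ C Y : Finset (Fin 11), Disjoint Y C → (C ∩ Y).card ≠ 1 := by
      intro C Y h h1
      rw [Finset.inter_comm, Finset.disjoint_iff_inter_eq_empty.1 h] at h1
      simp at h1
    by_cases hcom : ∃ a ∈ S, G.Adj x a ∧ G.Adj y a
    · obtain ⟨a, ha, hxa, hya⟩ := hcom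
      have e1 := hA' a ha hxa hya.ne'
      have e2 := hB' a ha hya hxa.ne'
      rw [e2] at e1
      subst e1
      exact exists_chord_coloring_of_eq hX hY hA hXY hxA hyB m hm
    · have e1 := hAy.resolve_left fun ⟨a, h1, h2, h3, _⟩ ↦ hcom ⟨a, h1, h2, h3⟩
      have e2 := hBx.resolve_left fun ⟨a, h1, h2, h3, _⟩ ↦ hcom ⟨a, h1, h3, h2⟩
      exact exists_chord_coloring_of_ne hX hY hA hB hXY hxA hyB e1 e2 m hm
  obtain ⟨c, h1, h2, h3, h4, h5⟩ := key
  exact ⟨c, h1, h2, h3, fun a ha hxa hay ↦ by rw [hA' a ha hxa hay, h4],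
    fun b hb hyb hbx ↦ by rw [hB' b hb hyb hbx, h5]⟩

/-- By `huniq`, only `x u` and `y v` lead from `S` into the component. So a shortest path in it
closes an induced cycle with `x y`, and the remaining old vertices constrain only the two path ends,
through `x` and `y`. -/
theorem exists_extension_of_edge [Fintype V] (hG : IsOuterplanar G) (hsub : IsSubcubic G)
    {S : Set V} (hS : IsClosedUnder G S) {f : V → Finset (Fin 11)} (hf : GoodOn G f S)
    {x y u v : V} (hx : x ∈ S) (hy : y ∈ S) (hu : u ∉ S) (hv : v ∉ S) (hxy : G.Adj x y)
    (hxu : G.Adj x u) (hyv : G.Adj y v) (huv : G.JoinedOn Sᶜ u v)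
    (huniq : ∀ b ∈ S, ∀ w ∉ S, G.Adj b w → G.JoinedOn Sᶜ u w →
      (b = x ∧ w = u) ∨ (b = y ∧ w = v)) :
    ∃ S' g, S ⊂ S' ∧ IsClosedUnder G S' ∧ GoodOn G g S' := by
  -- If `u = v` then `m = 0` and the cycle is a triangle. In general `m + 1` new vertices are added.
  obtain ⟨m, q, ⟨hq0, hqm⟩, hqS, hqadj, hqinj, hqind, -⟩ :=
    exists_geodesic (Q := fun a b ↦ a = u ∧ b = v) ⟨rfl, rfl⟩ huv
  have hjoin : ∀ i ≤ m, G.JoinedOn Sᶜ u (q i) := by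
    intro i hi
    rw [← hq0]
    refine (joinedOn_chain q (Nat.zero_le i) fun k _ hk ↦ hqadj k (by omega)).mono ?_
    rintro _ ⟨k, hk, rfl⟩
    exact hqS k (hk.2.trans hi)
  have hqadjS : ∀ b ∈ S, ∀ i ≤ m, G.Adj b (q i) → (b = x ∧ i = 0) ∨ (b = y ∧ i = m) := by
    intro b hb i hi h
    rcases huniq b hb (q i) (hqS i hi) h (hjoin i hi) with ⟨h1, h2⟩ | ⟨h1, h2⟩
    · exact Or.inl ⟨h1, hqinj i hi 0 (Nat.zero_le _) (h2.trans hq0.symm)⟩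
    · exact Or.inr ⟨h1, hqinj i hi m le_rfl (h2.trans hqm.symm)⟩
  let p : ℕ → V := fun i ↦ if i = 0 then x else if i ≤ m + 1 then q (i - 1) else y
  have hp0 : p 0 = x := rfl
  have hpq : ∀ i ≤ m, p (i + 1) = q i := fun i hi ↦ by simp [p, hi]
  have hpl : p (m + 2) = y := by simp [p]
  have hcases : ∀ i < m + 3, i = 0 ∨ (∃ j ≤ m, i = j + 1) ∨ i = m + 2 := by
    intro i hi
    rcases i with _ | i
    · exact Or.inl rfl
    · rcases Nat.lt_or_ge m i with h | h
      · exact Or.inr (Or.inr (by omega))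
      · exact Or.inr (Or.inl ⟨i, h, rfl⟩)
  have hcyc : IsInducedCycle G (m + 3) p := by
    have hxq : ∀ i ≤ m, (G.Adj x (q i) ↔ i = 0) := fun i hi ↦
      ⟨fun h ↦ (hqadjS x hx i hi h).elim (fun h ↦ h.2) fun h ↦ absurd h.1 hxy.ne,
        fun h ↦ by rw [h, hq0]; exact hxu⟩
    have hyq : ∀ i ≤ m, (G.Adj y (q i) ↔ i = m) := fun i hi ↦
      ⟨fun h ↦ (hqadjS y hy i hi h).elim (fun h ↦ absurd h.1 hxy.ne') fun h ↦ h.2,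
        fun h ↦ by rw [h, hqm]; exact hyv⟩
    have hxne : ∀ i ≤ m, q i ≠ x := fun i hi h ↦ hqS i hi (h ▸ hx)
    have hyne : ∀ i ≤ m, q i ≠ y := fun i hi h ↦ hqS i hi (h ▸ hy)
    refine ⟨by omega, ?_, ?_⟩
    · intro i hi j hj hij
      rcases hcases i hi with rfl | ⟨i, hi', rfl⟩ | rfl <;>
        rcases hcases j hj with rfl | ⟨j, hj', rfl⟩ | rfl
      · rfl
      · rw [hp0, hpq j hj'] at hij
        exact absurd hij.symm (hxne j hj')
      · rw [hp0, hpl] at hij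
        exact absurd hij hxy.ne
      · rw [hp0, hpq i hi'] at hij
        exact absurd hij (hxne i hi')
      · rw [hpq i hi', hpq j hj'] at hij
        rw [hqinj i hi' j hj' hij]
      · rw [hpl, hpq i hi'] at hij
        exact absurd hij (hyne i hi')
      · rw [hp0, hpl] at hij
        exact absurd hij hxy.ne'
      · rw [hpl, hpq j hj'] at hij
        exact absurd hij.symm (hyne j hj')
      · rfl
    · intro i hi j hj
      rcases hcases i hi with rfl | ⟨i, hi', rfl⟩ | rfl <;>
        rcases hcases j hj with rfl | ⟨j, hj', rfl⟩ | rfl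
      · simp
      · rw [hp0, hpq j hj', hxq j hj']
        omega
      · rw [hp0, hpl]
        simp [hxy]
      · rw [hp0, hpq i hi', G.adj_comm, hxq i hi']
        omega
      · rw [hpq i hi', hpq j hj']
        constructor
        · intro h
          have := hqind i hi' j hj' h
          omega
        · intro h
          have : j = i + 1 ∨ i = j + 1 := by omega
          rcases this with rfl | rfl
          · exact hqadj i (by omega)
          · exact (hqadj j (by omega)).symm
      · rw [hpl, hpq i hi', G.adj_comm, hyq i hi']
        omega
      · rw [hp0, hpl]
        simp [hxy.symm]
      · rw [hpl, hpq j hj', hyq j hj']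
        omega
      · simp
  have hD : ∀ d ∈ p '' Iio (m + 3), d ∉ S → ∃ i ≤ m, d = q i := by
    rintro _ ⟨i, hi, rfl⟩ hd
    rcases hcases i hi with rfl | ⟨i, hi', rfl⟩ | rfl
    · exact absurd hx hd
    · exact ⟨i, hi', hpq i hi'⟩
    · exact absurd (hpl ▸ hy) hd
  have hxD : x ∈ p '' Iio (m + 3) := ⟨0, by simp, rfl⟩
  have hyD : y ∈ p '' Iio (m + 3) := ⟨m + 2, by simp, hpl⟩
  have hcross : ∀ d ∈ p '' Iio (m + 3), d ∉ S → ∀ b ∈ S, b ∉ p '' Iio (m + 3) → ¬ G.Adj b d := by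
    intro d hd hdS b hb hbD h
    obtain ⟨i, hi, rfl⟩ := hD d hd hdS
    rcases hqadjS b hb i hi h with ⟨rfl, -⟩ | ⟨rfl, -⟩
    · exact hbD hxD
    · exact hbD hyD
  obtain ⟨c, hc, hc0, hcl, hc1, hcm⟩ :=
    hf.exists_chord_coloring hsub hx hy hu hv hxy hxu hyv (m + 1) (by omega)
  obtain ⟨g, hgS, hgp⟩ := hcyc.exists_extension S f c (by
    intro i hi hiS
    rcases hcases i hi with rfl | ⟨i, hi', rfl⟩ | rfl
    · exact hc0.symm
    · rw [hpq i hi'] at hiS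
      exact absurd hiS (hqS i hi')
    · rw [hpl]
      exact hcl.symm)
  refine ⟨S ∪ p '' Iio (m + 3), g, ?_, ?_, ?_⟩
  · refine (ssubset_iff_of_subset subset_union_left).2 ⟨u, Or.inr ⟨1, by simp, ?_⟩, hu⟩
    rw [hpq 0 (Nat.zero_le _), hq0]
  · refine hS.union_cycle hG hsub hcyc fun d hd hdS b hb w hw hdw hbw ↦ ?_
    obtain ⟨i, hi, rfl⟩ := hD d hd hdS
    have hwS : w ∉ S := fun h ↦ hw (Or.inl h)
    rcases huniq b hb w hwS hbw ((hjoin i hi).trans hdw) with ⟨rfl, -⟩ | ⟨rfl, -⟩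
    · exact hxD
    · exact hyD
  · refine (hf.congr hgS).union (hcyc.goodOn hc hgp) ?_ ?_ ?_ ?_
    · intro d hd hdS b hb hbD h
      exact absurd h.symm (hcross d hd hdS b hb hbD)
    · intro d hd hdS b hb hbD w hw _ hwd hwb
      by_cases hwS : w ∈ S
      · obtain ⟨i, hi, rfl⟩ := hD d hd hdS
        rcases hqadjS w hwS i hi hwd with ⟨rfl, rfl⟩ | ⟨rfl, rfl⟩
        · rw [← hpq 0 hi, hgp 1 (by omega), hgS b hb]
          exact hc1 b hb hwb fun h ↦ hbD (h ▸ hyD)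
        · rw [← hpq i hi, hgp (i + 1) (by omega), hgS b hb]
          exact hcm b hb hwb fun h ↦ hbD (h ▸ hxD)
      · exact absurd hwb.symm (hcross w (hw.resolve_left hwS) hwS b hb hbD)
    · intro d hd hdS _ _ w hw hwD hwd _
      exact absurd hwd (hcross d hd hdS w hw hwD)
    · intro b hb hbD _ _ w hw hwS hwb _
      exact absurd hwb.symm (hcross w hw hwS b hb hbD)

/-- `z` has at most two neighbors in `S`, because `r` is a third neighbor. Their labels are disjoint
or share one color, according to whether they are adjacent; missing neighbors are replaced by a
repeated or arbitrary label. -/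
theorem GoodOn.exists_pendant_label [Fintype V] (hsub : IsSubcubic G) {f : V → Finset (Fin 11)}
    {S : Set V} (hf : GoodOn G f S) {r : V} (hr : r ∉ S)
    (hone : ∀ b ∈ S, ∀ b' ∈ S, G.Adj b r → G.Adj b' r → b = b') :
    ∃ R Z : Finset (Fin 11), R.card = 3 ∧ Z.card = 3 ∧ Disjoint R Z ∧
      (∀ z ∈ S, G.Adj z r → f z = Z) ∧
      ∀ z ∈ S, ∀ a ∈ S, G.Adj z r → G.Adj z a → (R ∩ f a).card = 1 := by
  by_cases hz : ∃ z ∈ S, G.Adj z r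
  · obtain ⟨z, hz, hzr⟩ := hz
    have key : ∃ A B : Finset (Fin 11), A.card = 3 ∧ B.card = 3 ∧ Disjoint (f z) A ∧
        Disjoint (f z) B ∧ (A = B ∨ Disjoint A B ∨ (A ∩ B).card = 1) ∧
        ∀ a ∈ S, G.Adj z a → f a = A ∨ f a = B := by
      have hne : ∀ a ∈ S, a ≠ r := fun a ha h ↦ hr (h ▸ ha)
      by_cases h1 : ∃ a ∈ S, G.Adj z a
      · obtain ⟨a, ha, hza⟩ := h1
        by_cases h2 : ∃ b ∈ S, G.Adj z b ∧ a ≠ b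
        · obtain ⟨b, hb, hzb, hab⟩ := h2
          refine ⟨f a, f b, hf.1 a ha, hf.1 b hb, hf.2.1 z hz a ha hza, hf.2.1 z hz b hb hzb,
            Or.inr ?_, fun d hd hzd ↦ ?_⟩
          · by_cases hadj : G.Adj a b
            · exact Or.inl (hf.2.1 a ha b hb hadj)
            · exact Or.inr (hf.2.2 a ha b hb z hz hab hadj hza hzb)
          · rcases hsub.eq_of_adj hza hzb hzr hzd hab (hne a ha) (hne b hb) with rfl | rfl | rfl
            · exact Or.inl rfl
            · exact Or.inr rfl
            · exact absurd hd hr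
        · push Not at h2
          exact ⟨f a, f a, hf.1 a ha, hf.1 a ha, hf.2.1 z hz a ha hza, hf.2.1 z hz a ha hza,
            Or.inl rfl, fun d hd hzd ↦ Or.inl (by rw [h2 d hd hzd])⟩
      · push Not at h1
        obtain ⟨A, hA, hd⟩ := exists_disjoint_label (f z) (hf.1 z hz)
        exact ⟨A, A, hA, hA, hd, hd, Or.inl rfl, fun d hd hzd ↦ absurd hzd (h1 d hd)⟩
    obtain ⟨A, B, hA, hB, hzA, hzB, hAB, hcov⟩ := key
    obtain ⟨R, hR, hRZ, hRA, hRB⟩ := _root_.exists_pendant_label (hf.1 z hz) hA hB hzA hzB hAB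
    refine ⟨R, f z, hR, hf.1 z hz, hRZ, fun z' hz' h ↦ by rw [hone z' hz' z hz h hzr],
      fun z' hz' a ha h h' ↦ ?_⟩
    rw [hone z' hz' z hz h hzr] at h'
    rcases hcov a ha h' with h | h <;> rwa [h]
  · push Not at hz
    exact ⟨{0, 1, 2}, {3, 4, 5}, rfl, rfl, by decide, fun z h h' ↦ absurd h' (hz z h),
      fun z h _ _ h' ↦ absurd h' (hz z h)⟩

/-- If two neighbors of `r` are still joined without `r` and `S`, then `r` lies on an induced cycle,
which is added whole. Otherwise adding `r` alone keeps the set closed, since no component then sees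
`r` twice. -/
theorem exists_extension_of_vertex [Fintype V] (hG : IsOuterplanar G) (hsub : IsSubcubic G)
    {S : Set V} (hS : IsClosedUnder G S) {f : V → Finset (Fin 11)} (hf : GoodOn G f S)
    {r : V} (hr : r ∉ S)
    (huniq : ∀ b ∈ S, ∀ w ∉ S, G.Adj b w → G.JoinedOn Sᶜ r w → w = r)
    (hone : ∀ b ∈ S, ∀ b' ∈ S, G.Adj b r → G.Adj b' r → b = b') :
    ∃ S' g, S ⊂ S' ∧ IsClosedUnder G S' ∧ GoodOn G g S' := by
  classical
  obtain ⟨R, Z, hR, hZ, hRZ, hz, hza⟩ := hf.exists_pendant_label hsub hr hone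
  by_cases hcyc : ∃ a b, a ≠ b ∧ G.Adj r a ∧ G.Adj r b ∧ G.JoinedOn (S ∪ {r})ᶜ a b
  · obtain ⟨a, b, hab, hra, hrb, hj⟩ := hcyc
    obtain ⟨m, q, ⟨hq0m, hrq0, hrqm⟩, hqS, hqadj, hqinj, hqind, hqmin⟩ :=
      exists_geodesic (Q := fun a b ↦ a ≠ b ∧ G.Adj r a ∧ G.Adj r b) ⟨hab, hra, hrb⟩ hj
    have hm : 1 ≤ m := by
      rcases Nat.eq_zero_or_pos m with rfl | h
      · exact absurd rfl hq0m
      · exact h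
    have hqS' : ∀ i ≤ m, q i ∉ S := fun i hi h ↦ hqS i hi (Or.inl h)
    have hqr : ∀ i ≤ m, q i ≠ r := fun i hi h ↦ hqS i hi (Or.inr h)
    have hjoin : ∀ i ≤ m, G.JoinedOn Sᶜ r (q i) := by
      intro i hi
      refine (JoinedOn.of_adj hrq0 hr (hqS' 0 (Nat.zero_le m))).trans
        ((joinedOn_chain q (Nat.zero_le i) fun k _ hk ↦ hqadj k (by omega)).mono ?_)
      rintro _ ⟨k, hk, rfl⟩
      exact hqS' k (hk.2.trans hi)
    let p : ℕ → V := fun i ↦ if i = 0 then r else q (i - 1)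
    have hp0 : p 0 = r := rfl
    have hpq : ∀ i, p (i + 1) = q i := fun i ↦ rfl
    have hrq : ∀ i ≤ m, (G.Adj r (q i) ↔ i = 0 ∨ i = m) := by
      intro i hi
      constructor
      · intro h
        by_contra! h'
        -- A further neighbor `q i` of `r` would give a shorter path between distinct neighbors of
        -- `r`, starting at `q 0`.
        have := hqmin 0 i (Nat.zero_le _) hi
          ⟨fun h0 ↦ h'.1 (hqinj 0 (Nat.zero_le _) i hi h0).symm, hrq0, h⟩
        exact h'.2 this.2
      · rintro (rfl | rfl) <;> assumption
    have hC : IsInducedCycle G (m + 2) p := by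
      refine ⟨by omega, ?_, ?_⟩
      · rintro (_ | i) hi (_ | j) hj hij
        · rfl
        · exact absurd hij.symm (hqr j (by omega))
        · exact absurd hij (hqr i (by omega))
        · rw [hqinj i (by omega) j (by omega) hij]
      · rintro (_ | i) hi (_ | j) hj
        · simp
        · rw [hp0, hpq, hrq j (by omega)]
          omega
        · rw [hp0, hpq, G.adj_comm, hrq i (by omega)]
          omega
        · rw [hpq, hpq]
          constructor
          · intro h
            have := hqind i (by omega) j (by omega) h
            omega
          · intro h
            have : j = i + 1 ∨ i = j + 1 := by omega
            rcases this with rfl | rfl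
            · exact hqadj i (by omega)
            · exact (hqadj j (by omega)).symm
    have hDS : ∀ d ∈ p '' Iio (m + 2), d ∉ S := by
      rintro _ ⟨i, hi, rfl⟩
      simp only [mem_Iio] at hi
      rcases i with _ | i
      · exact hr
      · exact hqS' i (by omega)
    have hDj : ∀ d ∈ p '' Iio (m + 2), G.JoinedOn Sᶜ r d := by
      rintro _ ⟨i, hi, rfl⟩
      simp only [mem_Iio] at hi
      rcases i with _ | i
      · exact .refl hr
      · exact hjoin i (by omega)
    have hrD : r ∈ p '' Iio (m + 2) := ⟨0, by simp, rfl⟩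
    have hcross : ∀ d ∈ p '' Iio (m + 2), ∀ b ∈ S, G.Adj b d → d = r := fun d hd b hb h ↦
      huniq b hb d (hDS d hd) h (hDj d hd)
    obtain ⟨c, hc, hc0, hc1, hcm⟩ := exists_pendant_cycle_coloring hR hZ hRZ (m + 1) (by omega)
    obtain ⟨g, hgS, hgp⟩ := hC.exists_extension S f c
      (fun i hi h ↦ absurd h (hDS _ ⟨i, hi, rfl⟩))
    have hgr : g r = R := (hgp 0 (by omega)).trans hc0
    refine ⟨S ∪ p '' Iio (m + 2), g, ?_, ?_, ?_⟩
    · exact (ssubset_iff_of_subset subset_union_left).2 ⟨r, Or.inr hrD, hr⟩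
    · refine hS.union_cycle hG hsub hC fun d hd _ b hb w hw hdw hbw ↦ ?_
      have hwr := huniq b hb w (fun h ↦ hw (Or.inl h)) hbw ((hDj d hd).trans hdw)
      exact absurd (Or.inr (hwr ▸ hrD)) hw
    · refine (hf.congr hgS).union (hC.goodOn hc hgp) ?_ ?_ ?_ ?_
      · intro d hd _ b hb _ h
        have hdr := hcross d hd b hb h.symm
        rw [hdr] at h ⊢
        rw [hgr, hgS b hb, hz b hb h.symm]
        exact hRZ
      · intro d hd _ b hb _ w hw _ hwd hwb
        by_cases hwS : w ∈ S
        · have hdr := hcross d hd w hwS hwd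
          rw [hdr] at hwd ⊢
          rw [hgr, hgS b hb]
          exact hza w hwS b hb hwd hwb
        · have hwr := hcross w (hw.resolve_left hwS) b hb hwb.symm
          rw [hwr] at hwd hwb
          rw [hgS b hb, hz b hb hwb.symm]
          obtain ⟨i, hi, rfl⟩ := hd
          simp only [mem_Iio] at hi
          rcases i with _ | i
          · exact absurd rfl hwd.ne
          · rw [hpq, hrq i (by omega)] at hwd
            rw [hgp (i + 1) hi]
            rcases hwd with rfl | rfl
            · exact hc1
            · exact hcm
      · intro d hd _ d' hd' w hw _ h h'
        rw [hcross d hd w hw h, hcross d' hd' w hw h']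
      · intro b hb _ b' hb' w hw _ h h'
        have hwr := hcross w hw b hb h.symm
        rw [hwr] at h h'
        exact hone b hb b' hb' h.symm h'.symm
  · push Not at hcyc
    have hgS : ∀ v ∈ S, Function.update f r R v = f v := fun v hv ↦
      Function.update_of_ne (fun h : v = r ↦ hr (h ▸ hv)) _ _
    refine ⟨S ∪ {r}, Function.update f r R, ?_, ?_, ?_⟩
    · exact (ssubset_iff_of_subset subset_union_left).2 ⟨r, Or.inr rfl, hr⟩
    · intro a ha b hb u hu v hv hau hbv huv
      have huS : u ∉ S := fun h ↦ hu (Or.inl h)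
      have hvS : v ∉ S := fun h ↦ hv (Or.inl h)
      have huv' : G.JoinedOn Sᶜ u v := huv.mono (compl_subset_compl.2 subset_union_left)
      rcases ha with haS | rfl
      · rcases hb with hbS | rfl
        · exact hS a haS b hbS u huS v hvS hau hbv huv'
        · have := huniq a haS u huS hau ((JoinedOn.of_adj hbv hr hvS).trans huv'.symm)
          exact absurd (Or.inr this) hu
      · rcases hb with hbS | rfl
        · have := huniq b hbS v hvS hbv ((JoinedOn.of_adj hau hr huS).trans huv')
          exact absurd (Or.inr this) hv
        · refine Or.inl ⟨rfl, ?_⟩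
          by_contra hne
          exact hcyc u v hne hau hbv huv
    · refine (hf.congr hgS).union ?_ ?_ ?_ ?_ ?_
      · refine ⟨?_, ?_, ?_⟩
        · rintro v rfl
          simpa using hR
        · rintro u rfl v rfl h
          exact absurd rfl h.ne
        · rintro u rfl v rfl _ _ hne
          exact absurd rfl hne
      · rintro u rfl - b hb - h
        rw [Function.update_self, hgS b hb, hz b hb h.symm]
        exact hRZ
      · rintro u rfl - b hb - w hw - hwu hwb
        rcases hw with hwS | rfl
        · rw [Function.update_self, hgS b hb]
          exact hza w hwS b hb hwu hwb
        · exact absurd rfl hwu.ne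
      · rintro u rfl - v rfl _ _ _ _ _
        rfl
      · rintro b hb - b' hb' w rfl - h h'
        exact hone b hb b' hb' h.symm h'.symm

/-- A component that receives edges from `S` receives one edge or exactly two, which decides the
kind of extension. If no edge leaves `S`, a new component is started at any vertex. -/
theorem exists_extension [Fintype V] (hG : IsOuterplanar G) (hsub : IsSubcubic G)
    {S : Set V} (hS : IsClosedUnder G S) {f : V → Finset (Fin 11)} (hf : GoodOn G f S)
    (hne : S ≠ univ) : ∃ S' g, S ⊂ S' ∧ IsClosedUnder G S' ∧ GoodOn G g S' := by
  by_cases h : ∃ x ∈ S, ∃ u ∉ S, G.Adj x u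
  · obtain ⟨x, hx, u, hu, hxu⟩ := h
    by_cases h2 : ∃ y ∈ S, ∃ v ∉ S, G.Adj y v ∧ G.JoinedOn Sᶜ u v ∧ ¬ (x = y ∧ u = v)
    · obtain ⟨y, hy, v, hv, hyv, huv, hne⟩ := h2
      have hxy := (hS x hx y hy u hu v hv hxu hyv huv).resolve_left hne
      refine exists_extension_of_edge hG hsub hS hf hx hy hu hv hxy hxu hyv huv ?_
      intro b hb w hw hbw huw
      by_contra! hcon
      have hxb : G.Adj x b := (hS x hx b hb u hu w hw hxu hbw huw).resolve_left
        fun h ↦ hcon.1 h.1.symm h.2.symm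
      have hyb : G.Adj y b := (hS y hy b hb v hv w hw hyv hbw (huv.symm.trans huw)).resolve_left
        fun h ↦ hcon.2 h.1.symm h.2.symm
      have hnot : ∀ a ∈ S, ∀ b ∈ S, a ≠ b → a ∉ insert b Sᶜ := by
        rintro a ha b hb hab (h | h)
        · exact hab h
        · exact h ha
      -- A third attachment `b` would be adjacent to `x` and `y` by the invariant. The component,
      -- reached from `u`, then completes the triangle `x y b` to a `K₄` minor.
      refine hG.not_tetrahedron (w := u) ![x, y, b] ![insert x Sᶜ, insert y Sᶜ, insert b Sᶜ]
        ?_ ?_ ?_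
      · intro i j hij
        fin_cases i <;> fin_cases j <;>
          first
            | exact absurd rfl hij
            | assumption
            | (apply SimpleGraph.Adj.symm; assumption)
      · intro i
        fin_cases i
        · exact .of_adj hxu.symm (Or.inr hu) (Or.inl rfl)
        · exact (huv.mono (subset_insert _ _)).trans (.of_adj hyv.symm (Or.inr hv) (Or.inl rfl))
        · exact (huw.mono (subset_insert _ _)).trans (.of_adj hbw.symm (Or.inr hw) (Or.inl rfl))
      · intro i j hij
        fin_cases i <;> fin_cases j
        · exact absurd rfl hij
        · exact hnot x hx y hy hxy.ne
        · exact hnot x hx b hb hxb.ne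
        · exact hnot y hy x hx hxy.ne'
        · exact absurd rfl hij
        · exact hnot y hy b hb hyb.ne
        · exact hnot b hb x hx hxb.ne'
        · exact hnot b hb y hy hyb.ne'
        · exact absurd rfl hij
    · push Not at h2
      refine exists_extension_of_vertex hG hsub hS hf hu
        (fun b hb w hw hbw huw ↦ (h2 b hb w hw hbw huw).2.symm) fun b hb b' hb' h h' ↦ ?_
      rw [← (h2 b hb u hu h (.refl hu)).1, ← (h2 b' hb' u hu h' (.refl hu)).1]
  · push Not at h
    obtain ⟨r, hr⟩ := (ne_univ_iff_exists_notMem S).1 hne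
    exact exists_extension_of_vertex hG hsub hS hf hr
      (fun b hb w hw hbw _ ↦ absurd hbw (h b hb w hw)) fun b hb _ _ hbr _ ↦ absurd hbr (h b hb r hr)

theorem exists_isThreeGoodColoring [Fintype V] (hG : IsOuterplanar G) (hsub : IsSubcubic G) :
    ∃ f : V → Finset (Fin 11), IsThreeGoodColoring G 11 f := by
  have key : ∀ (k : ℕ) (S : Set V) (f : V → Finset (Fin 11)), Sᶜ.ncard = k →
      IsClosedUnder G S → GoodOn G f S → ∃ g, GoodOn G g univ := by
    intro k
    induction k using Nat.strong_induction_on with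
    | _ k ih =>
      intro S f hk hS hf
      by_cases hne : S = univ
      · exact ⟨f, hne ▸ hf⟩
      · obtain ⟨S', g, hSS', hS', hg⟩ := exists_extension hG hsub hS hf hne
        refine ih _ ?_ S' g rfl hS' hg
        rw [← hk]
        exact ncard_lt_ncard ⟨compl_subset_compl.2 hSS'.1, fun h ↦ hSS'.2 (compl_subset_compl.1 h)⟩ (toFinite _)
  obtain ⟨g, g1, g2, g3⟩ := key _ ∅ (fun _ ↦ ∅) rfl (fun a ha ↦ ha.elim)
    ⟨fun v hv ↦ hv.elim, fun v hv ↦ hv.elim, fun v hv ↦ hv.elim⟩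
  refine ⟨g, fun v ↦ g1 v trivial, fun u v h ↦ g2 u trivial v trivial h, fun u v h ↦ ?_⟩
  obtain ⟨hne, hadj, w, hw⟩ := edist_eq_two_iff.1 h
  rw [mem_commonNeighbors] at hw
  exact g3 u trivial v trivial w trivial hne hadj hw.1.symm hw.2.symm

/-- Only distance three needs an argument: equal labels on `u` and `v` are impossible, because the
neighbor of `u` on a shortest path shares a color with `v` but none with `u`. -/
theorem IsThreeGoodColoring.isToneColoring {k : ℕ} {f : V → Finset (Fin k)}
    (h : IsThreeGoodColoring G k f) : IsToneColoring G 3 k f := by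
  obtain ⟨h1, h2, h3⟩ := h
  refine ⟨h1, fun u v huv ↦ ?_⟩
  by_contra! hle
  have hcard : (f u ∩ f v).card ≤ 3 := (Finset.card_le_card Finset.inter_subset_left).trans
    (h1 u).le
  have hle3 : G.edist u v ≤ 3 := hle.trans (by exact_mod_cast hcard)
  obtain ⟨d, hd⟩ := ENat.ne_top_iff_exists.1 (ne_top_of_le_ne_top (by simp) hle3)
  rw [← hd] at hle hle3
  have hd3 : d ≤ 3 := by exact_mod_cast hle3
  have hled : d ≤ (f u ∩ f v).card := by exact_mod_cast hle
  interval_cases d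
  · exact huv (edist_eq_zero_iff.1 (by rw [← hd]; rfl))
  · have hadj := edist_eq_one_iff_adj.1 (show G.edist u v = 1 by rw [← hd]; rfl)
    rw [Finset.disjoint_iff_inter_eq_empty.1 (h2 u v hadj)] at hled
    simp at hled
  · rw [h3 u v (by rw [← hd]; rfl)] at hled
    omega
  · have heq : f u = f v := by
      have e1 := Finset.eq_of_subset_of_card_le (Finset.inter_subset_left : f u ∩ f v ⊆ f u)
        (by rw [h1 u]; exact hled)
      have e2 := Finset.eq_of_subset_of_card_le (Finset.inter_subset_right : f u ∩ f v ⊆ f v)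
        (by rw [h1 v]; exact hled)
      rw [← e1, e2]
    obtain ⟨W, hW⟩ := exists_walk_of_edist_eq_coe hd.symm
    have a0 := W.adj_getVert_succ (i := 0) (by omega)
    have a1 := W.adj_getVert_succ (i := 1) (by omega)
    have a2 := W.adj_getVert_succ (i := 2) (by omega)
    have hend : W.getVert 3 = v := by rw [← hW]; exact W.getVert_length
    rw [Walk.getVert_zero] at a0
    simp only [Nat.reduceAdd, hend] at a0 a1 a2
    have hd2 : G.edist (W.getVert 1) v = 2 := by
      refine edist_eq_two_iff.2 ⟨fun h ↦ ?_, fun h ↦ ?_, W.getVert 2, ?_⟩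
      · rw [h] at a0
        rw [edist_eq_one_iff_adj.2 a0] at hd
        exact absurd hd (by decide)
      · have hle2 := (Walk.cons a0 (.cons h .nil)).edist_le
        rw [← hd] at hle2
        have hle2' : 3 ≤ (Walk.cons a0 (.cons h .nil)).length := by exact_mod_cast hle2
        simp at hle2'
      · rw [mem_commonNeighbors]
        exact ⟨a1, a2.symm⟩
    have c1 := h3 _ _ hd2
    rw [← heq, Finset.inter_comm, Finset.disjoint_iff_inter_eq_empty.1 (h2 _ _ a0)] at c1
    simp at c1

theorem toneColorable_three_eleven [Fintype V] (hG : IsOuterplanar G) (hsub : IsSubcubic G) :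
    ToneColorable G 3 11 := by
  obtain ⟨f, hf⟩ := exists_isThreeGoodColoring hG hsub
  exact ⟨by norm_num, by norm_num, f, hf.isToneColoring⟩

end ToneColoring

/-! ### Sharpness: the house graph -/

namespace ToneColoring

open Set SimpleGraph

/-- The adjacency relation of the house graph as a table. -/
def houseAdj (a b : Fin 5) : Bool :=
  (a, b) ∈ [(0, 1), (1, 4), (4, 3), (3, 2), (2, 0), (1, 2), (1, 0), (4, 1), (3, 4), (2, 3), (0, 2),
    (2, 1)]

theorem houseGraph_adj {a b : Fin 5} : houseGraph.Adj a b ↔ houseAdj a b := by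
  simp only [houseGraph, fromEdgeSet_adj, mem_insert_iff, mem_singleton_iff]
  revert a b
  decide

theorem isSubcubic_houseGraph : IsSubcubic houseGraph := by
  classical
  unfold IsSubcubic
  refine maxDegree_le_of_forall_degree_le _ _ fun v ↦ ?_
  have h : houseGraph.neighborFinset v ⊆ Finset.univ.filter fun b ↦ houseAdj v b := by
    intro b hb
    rw [mem_neighborFinset, houseGraph_adj] at hb
    simpa only [Finset.mem_filter, Finset.mem_univ, true_and] using hb
  rw [← card_neighborFinset_eq_degree]
  refine (Finset.card_le_card h).trans ?_
  clear h
  revert v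
  decide

theorem completeFourMinusEdge_free_houseGraph : completeFourMinusEdge.Free houseGraph := by
  rintro ⟨f⟩
  have hadj : ∀ i j : Fin 4, i ≠ j → s(i, j) ≠ s(0, 1) → houseGraph.Adj (f i) (f j) := by
    intro i j hij hne
    refine f.toHom.map_adj ?_
    simpa [completeFourMinusEdge, deleteEdges_adj, hij] using hne
  have h01 : f 0 ≠ f 1 := f.injective.ne (by decide)
  have h02 := hadj 0 2 (by decide) (by decide)
  have h03 := hadj 0 3 (by decide) (by decide)
  have h12 := hadj 1 2 (by decide) (by decide)
  have h13 := hadj 1 3 (by decide) (by decide)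
  have h23 := hadj 2 3 (by decide) (by decide)
  rw [houseGraph_adj] at h02 h03 h12 h13 h23
  have key : ∀ a b c d : Fin 5, houseAdj c d → houseAdj a c → houseAdj a d → houseAdj b c →
      houseAdj b d → a = b := by
    decide
  exact h01 (key _ _ _ _ h23 h02 h03 h12 h13)

/-- The triangle `0 1 2` uses nine colors. Each of `3` and `4` is disjoint from one of these labels
and shares at most one color with each of the other two, so it needs a color outside the nine. As
`3` and `4` are adjacent, these two colors differ. -/
theorem le_of_toneColorable_houseGraph {k : ℕ} (h : ToneColorable houseGraph 3 k) : 11 ≤ k := by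
  obtain ⟨-, -, f, hf, hd⟩ := h
  have h1 : ∀ u v, houseGraph.Adj u v → Disjoint (f u) (f v) := by
    intro u v huv
    have := hd u v huv.ne
    rw [edist_eq_one_iff_adj.2 huv, Order.lt_one_iff] at this
    rw [Finset.disjoint_iff_inter_eq_empty, ← Finset.card_eq_zero]
    exact_mod_cast this
  have h2 : ∀ u v w, u ≠ v → houseGraph.Adj u w → houseGraph.Adj w v → (f u ∩ f v).card ≤ 1 := by
    intro u v w huv huw hwv
    have h3 := (hd u v huv).trans_le (Walk.cons huw (.cons hwv .nil)).edist_le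
    have h4 : (f u ∩ f v).card < 2 := by exact_mod_cast h3
    omega
  have d01 := h1 0 1 (houseGraph_adj.2 (by decide))
  have d02 := h1 0 2 (houseGraph_adj.2 (by decide))
  have d12 := h1 1 2 (houseGraph_adj.2 (by decide))
  have d41 := h1 4 1 (houseGraph_adj.2 (by decide))
  have d32 := h1 3 2 (houseGraph_adj.2 (by decide))
  have d43 := h1 4 3 (houseGraph_adj.2 (by decide))
  have e40 := h2 4 0 1 (by decide) (houseGraph_adj.2 (by decide)) (houseGraph_adj.2 (by decide))
  have e42 := h2 4 2 1 (by decide) (houseGraph_adj.2 (by decide)) (houseGraph_adj.2 (by decide))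
  have e30 := h2 3 0 2 (by decide) (houseGraph_adj.2 (by decide)) (houseGraph_adj.2 (by decide))
  have e31 := h2 3 1 2 (by decide) (houseGraph_adj.2 (by decide)) (houseGraph_adj.2 (by decide))
  have c4 : f 4 ⊆ (f 4 ∩ f 0) ∪ ((f 4 ∩ f 2) ∪ f 4 \ (f 0 ∪ (f 1 ∪ f 2))) := by
    have := Finset.disjoint_left.1 d41
    grind
  have c3 : f 3 ⊆ (f 3 ∩ f 0) ∪ ((f 3 ∩ f 1) ∪ f 3 \ (f 0 ∪ (f 1 ∪ f 2))) := by
    have := Finset.disjoint_left.1 d32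
    grind
  have k4 := Finset.card_le_card c4
  have k3 := Finset.card_le_card c3
  have l1 := Finset.card_union_le (f 4 ∩ f 0) ((f 4 ∩ f 2) ∪ f 4 \ (f 0 ∪ (f 1 ∪ f 2)))
  have l2 := Finset.card_union_le (f 4 ∩ f 2) (f 4 \ (f 0 ∪ (f 1 ∪ f 2)))
  have l3 := Finset.card_union_le (f 3 ∩ f 0) ((f 3 ∩ f 1) ∪ f 3 \ (f 0 ∪ (f 1 ∪ f 2)))
  have l4 := Finset.card_union_le (f 3 ∩ f 1) (f 3 \ (f 0 ∪ (f 1 ∪ f 2)))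
  have hu : (f 0 ∪ (f 1 ∪ f 2)).card = 9 := by
    rw [Finset.card_union_of_disjoint (Finset.disjoint_union_right.2 ⟨d01, d02⟩),
      Finset.card_union_of_disjoint d12, hf, hf, hf]
  have hdis : Disjoint (f 4 \ (f 0 ∪ (f 1 ∪ f 2))) (f 3 \ (f 0 ∪ (f 1 ∪ f 2))) :=
    d43.mono Finset.sdiff_subset Finset.sdiff_subset
  have hdis' : Disjoint (f 0 ∪ (f 1 ∪ f 2))
      (f 4 \ (f 0 ∪ (f 1 ∪ f 2)) ∪ f 3 \ (f 0 ∪ (f 1 ∪ f 2))) :=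
    Finset.disjoint_union_right.2 ⟨Finset.disjoint_sdiff, Finset.disjoint_sdiff⟩
  have hcard := Finset.card_le_univ ((f 0 ∪ (f 1 ∪ f 2)) ∪
      (f 4 \ (f 0 ∪ (f 1 ∪ f 2)) ∪ f 3 \ (f 0 ∪ (f 1 ∪ f 2))))
  rw [Finset.card_union_of_disjoint hdis', Finset.card_union_of_disjoint hdis, hu,
    Fintype.card_fin] at hcard
  have := hf 4
  have := hf 3
  omega

/-- The point of the parabola `y = x ^ 2` with first coordinate `x`. -/
noncomputable def parabola (x : ℝ) : Plane := !₂[x, x ^ 2]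

@[simp] theorem parabola_zero (x : ℝ) : parabola x 0 = x := rfl

@[simp] theorem parabola_one (x : ℝ) : parabola x 1 = x ^ 2 := rfl

theorem parabola_injective : Function.Injective parabola := fun x y h ↦ by
  simpa using congrArg (fun z : Plane ↦ z 0) h

theorem eq_parabola {z : Plane} {x : ℝ} (h0 : z 0 = x) (h1 : z 1 = x ^ 2) : z = parabola x := by
  ext i
  fin_cases i
  · exact h0
  · exact h1

theorem exists_of_mem_segment_parabola {x y : ℝ} {z : Plane}
    (h : z ∈ segment ℝ (parabola x) (parabola y)) :
    ∃ a b : ℝ, 0 ≤ a ∧ 0 ≤ b ∧ a + b = 1 ∧ z 0 = a * x + b * y ∧ z 1 = a * x ^ 2 + b * y ^ 2 := by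
  obtain ⟨a, b, ha, hb, hab, rfl⟩ := h
  exact ⟨a, b, ha, hb, hab, by simp, by simp⟩

theorem le_of_mem_segment_parabola {x y : ℝ} {z : Plane}
    (h : z ∈ segment ℝ (parabola x) (parabola y)) : z 0 ^ 2 ≤ z 1 := by
  obtain ⟨a, b, ha, hb, hab, h0, h1⟩ := exists_of_mem_segment_parabola h
  obtain rfl : b = 1 - a := by linarith
  rw [h0, h1]
  nlinarith [mul_nonneg (mul_nonneg ha hb) (sq_nonneg (x - y))]

/-- Strict convexity: a chord meets the parabola only at its ends. -/
theorem eq_or_eq_of_parabola_mem_segment {x y w : ℝ}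
    (h : parabola w ∈ segment ℝ (parabola x) (parabola y)) : w = x ∨ w = y := by
  obtain ⟨a, b, ha, hb, hab, h0, h1⟩ := exists_of_mem_segment_parabola h
  simp only [parabola_zero, parabola_one] at h0 h1
  have : (w - x) * (w - y) = 0 := by
    obtain rfl : b = 1 - a := by linarith
    subst h0
    nlinarith
  rcases mul_eq_zero.1 this with h | h
  · exact Or.inl (by linarith)
  · exact Or.inr (by linarith)

/-- The abscissae of the vertices of the house graph in its drawing on the parabola. -/
def houseAbscissa : Fin 5 → ℝ := ![0, 1, 4, 3, 2]

theorem houseAbscissa_injective : Function.Injective houseAbscissa := by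
  rw [← List.nodup_ofFn]
  simp [houseAbscissa]

theorem mem_edgeSet_houseGraph {e : Sym2 (Fin 5)} (he : e ∈ houseGraph.edgeSet) :
    e = s(0, 1) ∨ e = s(1, 4) ∨ e = s(4, 3) ∨ e = s(3, 2) ∨ e = s(2, 0) ∨ e = s(1, 2) := by
  rw [houseGraph, edgeSet_fromEdgeSet] at he
  simpa using he.1

/-- The straight line drawing of the house graph with vertices on the parabola `y = x ^ 2`. -/
noncomputable def houseEmbedding : PlanarEmbedding houseGraph where
  point v := parabola (houseAbscissa v)
  arc := Sym2.lift ⟨fun u v ↦ segment ℝ (parabola (houseAbscissa u)) (parabola (houseAbscissa v)),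
    fun _ _ ↦ segment_symm ℝ _ _⟩
  point_injective := parabola_injective.comp houseAbscissa_injective
  isArc u v huv := by
    have hne : parabola (houseAbscissa u) ≠ parabola (houseAbscissa v) :=
      (parabola_injective.comp houseAbscissa_injective).ne huv.ne
    refine ⟨Path.segment _ _, fun s t h ↦ Subtype.ext (AffineMap.lineMap_injective ℝ hne ?_),
      Path.range_segment _ _⟩
    simpa only [Path.segment_apply] using h
  mem_of_point_mem_arc e _ w hw := by
    induction e with
    | h u v =>
      rw [Sym2.lift_mk] at hw
      rcases eq_or_eq_of_parabola_mem_segment hw with h | h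
      · simp [houseAbscissa_injective h]
      · simp [houseAbscissa_injective h]
  arc_inter_arc e he e' he' hne := by
    rintro z ⟨hz, hz'⟩
    have key : z 0 = 0 ∧ z 1 = 0 ∨ z 0 = 1 ∧ z 1 = 1 ∨ z 0 = 4 ∧ z 1 = 16 ∨
        z 0 = 3 ∧ z 1 = 9 ∨ z 0 = 2 ∧ z 1 = 4 := by
      rcases mem_edgeSet_houseGraph he with rfl | rfl | rfl | rfl | rfl | rfl <;>
      rcases mem_edgeSet_houseGraph he' with rfl | rfl | rfl | rfl | rfl | rfl <;>
      first
      | exact absurd rfl hne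
      | (obtain ⟨a, b, ha, hb, hab, h0, h1⟩ := exists_of_mem_segment_parabola hz
         obtain ⟨c, d, hc, hd, hcd, h2, h3⟩ := exists_of_mem_segment_parabola hz'
         simp only [houseAbscissa, Matrix.cons_val] at h0 h1 h2 h3
         first
         | (exfalso; linarith)
         | exact Or.inl ⟨by linarith, by linarith⟩
         | exact Or.inr (Or.inl ⟨by linarith, by linarith⟩)
         | exact Or.inr (Or.inr (Or.inl ⟨by linarith, by linarith⟩))
         | exact Or.inr (Or.inr (Or.inr (Or.inl ⟨by linarith, by linarith⟩)))
         | exact Or.inr (Or.inr (Or.inr (Or.inr ⟨by linarith, by linarith⟩))))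
    rcases key with ⟨h0, h1⟩ | ⟨h0, h1⟩ | ⟨h0, h1⟩ | ⟨h0, h1⟩ | ⟨h0, h1⟩
    · exact ⟨0, (eq_parabola h0 (by rw [h1]; norm_num [houseAbscissa])).symm⟩
    · exact ⟨1, (eq_parabola h0 (by rw [h1]; norm_num [houseAbscissa])).symm⟩
    · exact ⟨2, (eq_parabola h0 (by rw [h1]; norm_num [houseAbscissa])).symm⟩
    · exact ⟨3, (eq_parabola h0 (by rw [h1]; norm_num [houseAbscissa])).symm⟩
    · exact ⟨4, (eq_parabola h0 (by rw [h1]; norm_num [houseAbscissa])).symm⟩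

theorem le_of_mem_support_houseEmbedding {z : Plane} (hz : z ∈ houseEmbedding.support) :
    z 0 ^ 2 ≤ z 1 := by
  rcases hz with ⟨v, rfl⟩ | hz
  · exact le_rfl
  · obtain ⟨e, -, hz⟩ := mem_iUnion₂.1 hz
    induction e with
    | h u v => exact le_of_mem_segment_parabola hz

/-- The shear `(x, t) ↦ (x, x ^ 2 + t)` maps the lower half plane onto this region. -/
theorem isPreconnected_below_parabola : IsPreconnected {z : Plane | z 1 < z 0 ^ 2} := by
  have h : {z : Plane | z 1 < z 0 ^ 2} =
      (fun q : ℝ × ℝ ↦ (!₂[q.1, q.1 ^ 2 + q.2] : Plane)) '' (univ ×ˢ Iio 0) := by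
    ext z
    constructor
    · intro hz
      refine ⟨(z 0, z 1 - z 0 ^ 2), ⟨trivial, show z 1 - z 0 ^ 2 < 0 from sub_neg.2 hz⟩, ?_⟩
      ext i
      fin_cases i <;> simp
    · rintro ⟨q, ⟨-, hq⟩, rfl⟩
      have : q.2 < 0 := hq
      simp [this]
  rw [h]
  refine (isPreconnected_univ.prod isPreconnected_Iio).image _ (Continuous.continuousOn ?_)
  refine (PiLp.continuous_toLp 2 _).comp (continuous_pi fun i ↦ ?_)
  fin_cases i <;> simp <;> fun_prop

/-- The region below the parabola is connected and unbounded, misses the drawing and has every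
vertex in its closure, so the face containing it is outer and touches all vertices. -/
theorem isOuterplanar_houseGraph : IsOuterplanar houseGraph := by
  have hsub : {z : Plane | z 1 < z 0 ^ 2} ⊆ houseEmbedding.supportᶜ := fun z hz h ↦
    absurd (le_of_mem_support_houseEmbedding h) (not_le.2 hz)
  have ho : (!₂[0, -1] : Plane) ∈ {z : Plane | z 1 < z 0 ^ 2} := by simp
  have hF : {z : Plane | z 1 < z 0 ^ 2} ⊆
      connectedComponentIn houseEmbedding.supportᶜ !₂[0, -1] :=
    isPreconnected_below_parabola.subset_connectedComponentIn ho hsub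
  refine ⟨houseEmbedding, _, ⟨⟨_, hsub ho, rfl⟩, fun hb ↦ ?_⟩, fun v ↦ ⟨?_, fun h ↦ ?_⟩⟩
  · obtain ⟨C, hC⟩ := isBounded_iff_forall_norm_le.1 (hb.subset hF)
    have h1 := hC !₂[0, -(|C| + 1)] (by
      simp only [mem_ofPred_eq, Matrix.cons_val]
      have := abs_nonneg C
      linarith)
    have h2 := PiLp.norm_apply_le (!₂[0, -(|C| + 1)] : Plane) 1
    simp only [Matrix.cons_val, Real.norm_eq_abs, abs_neg] at h2
    have h3 := le_abs_self (|C| + 1)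
    have h4 := le_abs_self C
    linarith
  · refine closure_mono hF ?_
    have hcont : Continuous fun t : ℝ ↦
        (!₂[houseAbscissa v, houseAbscissa v ^ 2 - t] : Plane) := by
      refine (PiLp.continuous_toLp 2 _).comp (continuous_pi fun i ↦ ?_)
      fin_cases i <;> simp <;> fun_prop
    have h0 : (0 : ℝ) ∈ closure (Ioi 0) := by simp
    have := map_mem_closure hcont h0 (t := {z : Plane | z 1 < z 0 ^ 2}) fun t ht ↦ by
      have : 0 < t := ht
      simp [this]
    simpa [houseEmbedding, parabola] using this
  · exact connectedComponentIn_subset _ _ (interior_subset h) (Or.inl ⟨v, rfl⟩)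

end ToneColoring

theorem mainTheorem4 :
    (∀ (V : Type*) [Fintype V] (G : SimpleGraph V),
      ToneColoring.IsSubcubic G → ToneColoring.IsOuterplanar G →
        (∃ f : V → Finset (Fin 11), ToneColoring.IsThreeGoodColoring G 11 f) ∧
        ToneColoring.ToneColorable G 3 11 ∧
        ToneColoring.toneChromaticNumber G 3 ≤ 11) ∧
    (ToneColoring.IsSubcubic ToneColoring.houseGraph ∧
      ToneColoring.IsOuterplanar ToneColoring.houseGraph ∧
      ToneColoring.completeFourMinusEdge.Free ToneColoring.houseGraph ∧
      ¬ ToneColoring.ToneColorable ToneColoring.houseGraph 3 10 ∧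
      ToneColoring.toneChromaticNumber ToneColoring.houseGraph 3 = 11) := by
  refine ⟨fun V _ G hsub hG ↦ ⟨ToneColoring.exists_isThreeGoodColoring hG hsub,
    ToneColoring.toneColorable_three_eleven hG hsub,
    Nat.sInf_le (ToneColoring.toneColorable_three_eleven hG hsub)⟩,
    ToneColoring.isSubcubic_houseGraph, ToneColoring.isOuterplanar_houseGraph,
    ToneColoring.completeFourMinusEdge_free_houseGraph, fun h ↦ ?_, ?_⟩
  · exact absurd (ToneColoring.le_of_toneColorable_houseGraph h) (by norm_num)
  · have h := ToneColoring.toneColorable_three_eleven ToneColoring.isOuterplanar_houseGraph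
      ToneColoring.isSubcubic_houseGraph
    exact le_antisymm (Nat.sInf_le h) (ToneColoring.le_of_toneColorable_houseGraph
      (Nat.sInf_mem (s := {k | ToneColoring.ToneColorable ToneColoring.houseGraph 3 k}) ⟨11, h⟩))
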